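/- Let $\Omega$ be either $\mathbb R^3$ or the torus $\mathbb T^3=(\mathbb R/\mathbb Z)^3$. The Landau equation with Coulomb potential, for a density $f=f(t,x,v)$ with $t\ge 0$, $x\in\Omega$, $v\in\mathbb R^3$, is $$\partial_t f+v\cdot\nabla_x f=Q_L(f),\qquad Q_L(f)=\frac1{8\pi}\,\nabla_v\cdot\int_{\mathbb R^3}\frac{\Pi(v-v_*)}{|v-v_*|}\bigl(f(v_*)\nabla_v f(v)-f(v)\nabla_{v_*}f(v_*)\bigr)\,dv_*,\qquad \Pi(w)=\mathrm{Id}-\frac{w\otimes w}{|w|^2}.$$ Write $\langle v\rangle=(1+|v|^2)^{1/2}$, $\|h\|_{L^\infty}=\operatorname{ess\,sup}_{\Omega\times\mathbb R^3}|h|$ and $\|h\|_{L^\infty_m}=\|\langle v\rangle^m h\|_{L^\infty}$. Call $f\colon[0,T]\times\Omega\times\mathbb R^3\to\mathbb R$ smooth and rapidly decaying if it is $C^\infty$ on $[0,T]\times\Omega\times\mathbb R^3$ and each of its partial derivatives in $(t,x,v)$, of any order (including order zero), decays faster than any power of $1+|x|+|v|$ (of $1+|v|$ if $\Omega=\mathbb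 T^3$), uniformly in $t\in[0,T]$; that is, $f\in C^\infty([0,T];\mathcal S(\Omega\times\mathbb R^3))$. **Proposition 1.3.** For every non-integer $m\in(2,5)$ there is a constant $K=K(m)$, depending only on $m$, such that the following holds for $\Omega=\mathbb R^3$ and for $\Omega=\mathbb T^3$. If $f\colon[0,T]\times\Omega\times\mathbb R^3\to[0,\infty)$ is smooth and rapidly decaying and solves the Landau equation with initial datum $f_{\rm in}=f(0)$, then $$\|f(t)\|_{L^\infty_m}\le\exp\Bigl(K\int_0^t\|f(s)\|_{L^\infty}\,ds\Bigr)\,\|f_{\rm in}\|_{L^\infty_m}\qquad\text{for every }0\le t\le T.$$ -/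

import Mathlib

open MeasureTheory Set
open scoped ENNReal ContDiff

namespace Landau

/-- Velocity space `ℝ³` (also the spatial domain in the whole-space case), with its Euclidean norm. -/
abbrev Vec3 : Type := EuclideanSpace ℝ (Fin 3)

/-- The three dimensional torus `𝕋³ = (ℝ/ℤ)³`. -/
abbrev Torus3 : Type := UnitAddTorus (Fin 3)

/-- The covering map `ℝ³ → 𝕋³`. -/
def toTorus (x : Vec3) : Torus3 := fun i => (x i : UnitAddCircle)

/-- The Japanese bracket `⟨v⟩ = (1 + |v|²)^{1/2}`. -/
noncomputable def bracket (v : Vec3) : ℝ := Real.sqrt (1 + ‖v‖ ^ 2)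

/-- The matrix `Π(z) = Id - z ⊗ z / |z|²`, acting on the vector `y`. -/
noncomputable def Proj (z y : Vec3) : Vec3 := y - (inner ℝ z y / ‖z‖ ^ 2) • z

/-- The velocity flux of the Coulomb Landau collision operator,
`J[h](v) = (1/8π) ∫ |v - w|⁻¹ Π(v - w) (h(w) ∇h(v) - h(v) ∇h(w)) dw`. -/
noncomputable def flux (h : Vec3 → ℝ) (v : Vec3) : Vec3 :=
  (1 / (8 * Real.pi)) •
    ∫ w : Vec3, ‖v - w‖⁻¹ • Proj (v - w) (h w • gradient h v - h v • gradient h w)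

/-- The divergence of a vector field on `ℝ³`. -/
noncomputable def divergence (J : Vec3 → Vec3) (v : Vec3) : ℝ :=
  ∑ i : Fin 3, (fderiv ℝ J v (EuclideanSpace.single i 1)) i

/-- The Landau collision operator with Coulomb potential, in collisional form. -/
noncomputable def collision (h : Vec3 → ℝ) (v : Vec3) : ℝ := divergence (flux h) v

section PhaseSpace

/- In the two cases of interest, `X` is `ℝ³` with `cover = id`, or `𝕋³` with `cover = toTorus`.
Derivatives in the position variable are those of the lift along `cover`. -/
variable {X : Type} [NormedAddCommGroup X]

/-- The lift of a phase-space density to `ℝ × ℝ³ × ℝ³`. -/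
def lift (cover : Vec3 → X) (f : ℝ → X → Vec3 → ℝ) : ℝ × Vec3 × Vec3 → ℝ :=
  fun p => f p.1 (cover p.2.1) p.2.2

/-- `f` is smooth on `[0,T] × X × ℝ³` and rapidly decaying: `f ∈ C^∞([0,T]; 𝓢(X × ℝ³))`. Every
derivative of `f` in `(t,x,v)` (one-sided in time at the end points) decays faster than any power of
`1 + |x| + |v|`, uniformly in time. The norm of the torus is bounded, so that there only decay in
`v` is required. -/
structure SmoothRapidlyDecaying (cover : Vec3 → X) (T : ℝ) (f : ℝ → X → Vec3 → ℝ) : Prop where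
  smooth : ContDiffOn ℝ ∞ (lift cover f) (Icc 0 T ×ˢ univ)
  decay : ∀ k N : ℕ, ∃ C : ℝ, ∀ t ∈ Icc 0 T, ∀ x v : Vec3,
    (1 + ‖cover x‖ + ‖v‖) ^ N *
      ‖iteratedFDerivWithin ℝ k (lift cover f) (Icc 0 T ×ˢ univ) (t, x, v)‖ ≤ C

/-- `f` satisfies `∂ₜ f + v · ∇ₓ f = Q_L(f)` pointwise on `(0,T) × X × ℝ³`. -/
def SolvesLandau (cover : Vec3 → X) (T : ℝ) (f : ℝ → X → Vec3 → ℝ) : Prop :=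
  ∀ t ∈ Ioo 0 T, ∀ x v : Vec3,
    deriv (fun s => f s (cover x) v) t + inner ℝ v (gradient (fun y => f t (cover y) v) x)
      = collision (f t (cover x)) v

/-- The norm of `L^∞(X × ℝ³)`. -/
noncomputable def normLinf [MeasureSpace X] (h : X → Vec3 → ℝ) : ℝ≥0∞ :=
  eLpNorm (fun p : X × Vec3 => h p.1 p.2) ∞ volume

/-- The norm of `L^∞_m(X × ℝ³)`, that is, the `L^∞` norm of `⟨v⟩^m h`. -/
noncomputable def normLinfWeighted [MeasureSpace X] (m : ℝ) (h : X → Vec3 → ℝ) : ℝ≥0∞ :=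
  normLinf (fun x v => bracket v ^ m * h x v)

end PhaseSpace

end Landau

namespace Landau
open Filter Topology
open scoped SchwartzMap LineDeriv

/-! The proof is a maximum principle for `⟨v⟩^m f`. With `a = f ∗ (Π(z)/|z|)`, the operator reads
`8π Q_L(f) = a_ij ∂_ij f - f ∂_ij a_ij` (`collision_eq`). Where `⟨v⟩^m f(t, ·, ·)` is maximal, `∇ₓ f
= 0` and `f` touches a multiple of `⟨v⟩^{-m}` from below, and there both terms of `Q_L` are at most
a constant times `‖f‖_∞ f`.

Second-order term: the Hessian of `f` lies below that of the barrier, hence below `m(m+2) f ⟨v⟩^{-2}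
Id` (`hessian_le_of_touching`). The kernel is nonnegative with trace `2/|z|`, so the contraction
costs `∫ f(v+z)/|z| dz`. This integral is `O(⟨v⟩² ‖f‖_∞)` by the barrier and `m > 2`
(`integral_norm_inv_mul_le`), and the powers of `⟨v⟩` cancel.

Zeroth-order term: the double divergence of `Π(z)/|z|` is a multiple of the Dirac mass. Only
boundedness on `L^∞` is needed; it comes from a regularised kernel whose double divergence is an
explicit approximate identity (`abs_integral_coulombKernel_hessian_le`).

Thus `Q_L(f) ≤ K ‖f‖_∞ f` at a maximum (`exists_collision_le`). The factor `exp(-K ∫ ‖f‖_∞ - ε t)`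
then rules out growth (`weighted_le_of_damping`), and `ε → 0` gives the estimate. -/

/-- The standard basis vectors of velocity space. -/
noncomputable abbrev basisVec (i : Fin 3) : Vec3 := EuclideanSpace.single i 1

/-! ### Integrable weights and decay of Schwartz functions. -/

/-- Coulomb weight with power tail. -/
noncomputable def tailWeight (m : ℝ) (z : Vec3) : ℝ := ‖z‖⁻¹ * min 1 (‖z‖ ^ (-m))

/-- In polar coordinates the integrand is at most `r` near the origin and `r^(1-m)` at infinity; the
latter is where `m > 2` enters. -/
lemma integrable_tailWeight {m : ℝ} (hm : 2 < m) : Integrable (tailWeight m) := by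
  have key : Integrable (fun z : Vec3 => (fun y : ℝ => y⁻¹ * min 1 (y ^ (-m))) ‖z‖) := by
    rw [integrable_fun_norm_addHaar (μ := volume) (f := fun y : ℝ => y⁻¹ * min 1 (y ^ (-m)))]
    simp only [finrank_euclideanSpace, Fintype.card_fin, smul_eq_mul]
    have hu : Ioi (0 : ℝ) = Ioc 0 1 ∪ Ioi 1 := (Ioc_union_Ioi_eq_Ioi zero_le_one).symm
    have hmeas : Measurable (fun y : ℝ => y ^ (3 - 1) * (y⁻¹ * min 1 (y ^ (-m)))) := by fun_prop
    rw [hu, integrableOn_union]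
    constructor
    · refine Measure.integrableOn_of_bounded (M := 1) (by simp) hmeas.aestronglyMeasurable ?_
      refine (ae_restrict_iff' measurableSet_Ioc).2 (.of_forall fun y hy => ?_)
      have h0 : 0 < y := hy.1
      have hmin : 0 ≤ min 1 (y ^ (-m)) := le_min zero_le_one (by positivity)
      rw [Real.norm_of_nonneg (by positivity)]
      have : y ^ (3 - 1) * (y⁻¹ * min 1 (y ^ (-m))) = y * min 1 (y ^ (-m)) := by
        field_simp
      rw [this]
      calc y * min 1 (y ^ (-m)) ≤ 1 * 1 :=
            mul_le_mul hy.2 (min_le_left _ _) hmin zero_le_one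
        _ = 1 := one_mul 1
    · refine Integrable.mono' (integrableOn_Ioi_rpow_of_lt (a := 1 - m) (by linarith) zero_lt_one)
        hmeas.aestronglyMeasurable ?_
      refine (ae_restrict_iff' measurableSet_Ioi).2 (.of_forall fun y hy => ?_)
      have h0 : 0 < y := zero_lt_one.trans hy
      have hmin : 0 ≤ min 1 (y ^ (-m)) := le_min zero_le_one (by positivity)
      rw [Real.norm_of_nonneg (by positivity)]
      have : y ^ (3 - 1) * (y⁻¹ * min 1 (y ^ (-m))) = y * min 1 (y ^ (-m)) := by
        field_simp
      rw [this, sub_eq_add_neg, Real.rpow_add h0, Real.rpow_one]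
      exact mul_le_mul_of_nonneg_left (min_le_right _ _) h0.le
  exact key

/-- An inverse power of `1 + ‖z‖` times the Coulomb singularity is integrable. -/
lemma integrable_norm_inv_mul_decay :
    Integrable (fun z : Vec3 => ‖z‖⁻¹ * ((1 + ‖z‖) ^ 4)⁻¹) := by
  refine Integrable.mono' (integrable_tailWeight (m := 4) (by norm_num))
    (by fun_prop) (.of_forall fun z => ?_)
  rw [Real.norm_of_nonneg (by positivity)]
  rcases (norm_nonneg z).eq_or_lt with h | h
  · simp [tailWeight, ← h]
  refine mul_le_mul_of_nonneg_left (le_min ?_ ?_) (by positivity)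
  · exact inv_le_one_of_one_le₀ (one_le_pow₀ (by linarith [norm_nonneg z]))
  · rw [Real.rpow_neg h.le]
    refine inv_anti₀ (by positivity) ?_
    rw [show (4 : ℝ) = ((4 : ℕ) : ℝ) by norm_num, Real.rpow_natCast]
    gcongr
    linarith

lemma exists_decay {E F : Type*} [NormedAddCommGroup E] [NormedSpace ℝ E]
    [NormedAddCommGroup F] [NormedSpace ℝ F] (u : 𝓢(E, F)) (N : ℕ) :
    ∃ C, 0 ≤ C ∧ ∀ x, ‖u x‖ ≤ C * ((1 + ‖x‖) ^ N)⁻¹ := by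
  refine ⟨2 ^ N * (Finset.Iic (N, 0)).sup (fun m => SchwartzMap.seminorm ℝ m.1 m.2) u,
    by positivity, fun x => ?_⟩
  have := SchwartzMap.one_add_le_sup_seminorm_apply (𝕜 := ℝ) (m := (N, 0)) (k := N) (n := 0)
    le_rfl le_rfl u x
  rw [norm_iteratedFDeriv_zero] at this
  rw [← div_eq_mul_inv, le_div_iff₀ (by positivity), mul_comm]
  exact this

/-- Decay of translates, uniformly for the translation in a unit ball. -/
lemma exists_decay_translate {E F : Type*} [NormedAddCommGroup E] [NormedSpace ℝ E]
    [NormedAddCommGroup F] [NormedSpace ℝ F] (u : 𝓢(E, F)) (N : ℕ) (v₀ : E) :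
    ∃ C, 0 ≤ C ∧ ∀ v ∈ Metric.ball v₀ 1, ∀ z, ‖u (v + z)‖ ≤ C * ((1 + ‖z‖) ^ N)⁻¹ := by
  obtain ⟨C, hC, h⟩ := exists_decay u N
  refine ⟨C * (2 + ‖v₀‖) ^ N, by positivity, fun v hv z => (h _).trans ?_⟩
  rw [mul_assoc]
  refine mul_le_mul_of_nonneg_left ?_ hC
  rw [← div_eq_mul_inv, le_div_iff₀ (by positivity), ← div_eq_inv_mul,
    div_le_iff₀ (by positivity), ← mul_pow]
  gcongr
  have h1 : ‖v‖ ≤ ‖v₀‖ + 1 := by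
    have := norm_sub_norm_le v v₀
    rw [mem_ball_iff_norm] at hv
    linarith
  have h2 : ‖z‖ ≤ ‖v + z‖ + ‖v‖ := by
    simpa [add_sub_cancel_left] using norm_sub_le (v + z) v
  nlinarith [norm_nonneg v₀, norm_nonneg (v + z)]

/-! ### Integration by parts of bounded kernels against Schwartz functions. -/

/-- Bounded continuous functions, as a predicate. -/
def BddCont (κ : Vec3 → ℝ) : Prop := Continuous κ ∧ ∃ C, ∀ z, |κ z| ≤ C

namespace BddCont
variable {κ κ' : Vec3 → ℝ}

lemma const (c : ℝ) : BddCont fun _ => c := ⟨continuous_const, |c|, fun _ => le_rfl⟩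

lemma add (h : BddCont κ) (h' : BddCont κ') : BddCont fun z => κ z + κ' z := by
  obtain ⟨C, hC⟩ := h.2
  obtain ⟨C', hC'⟩ := h'.2
  exact ⟨h.1.add h'.1, C + C', fun z => (abs_add_le _ _).trans (add_le_add (hC z) (hC' z))⟩

lemma mul (h : BddCont κ) (h' : BddCont κ') : BddCont fun z => κ z * κ' z := by
  obtain ⟨C, hC⟩ := h.2
  obtain ⟨C', hC'⟩ := h'.2
  refine ⟨h.1.mul h'.1, C * C', fun z => ?_⟩
  rw [abs_mul]
  exact mul_le_mul (hC z) (hC' z) (abs_nonneg _) ((abs_nonneg _).trans (hC z))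

lemma integrable_mul_translate (h : BddCont κ) (p : 𝓢(Vec3, ℝ)) (v : Vec3) :
    Integrable fun z => κ z * p (v + z) := by
  obtain ⟨C, hC⟩ := h.2
  exact (p.integrable.comp_add_left v).bdd_mul h.1.aestronglyMeasurable
    (.of_forall fun z => hC z)

lemma integral_mul_lineDeriv (h : BddCont κ) (h' : BddCont κ') (e : Vec3)
    (hd : ∀ z, HasLineDerivAt ℝ κ (κ' z) z e) (p : 𝓢(Vec3, ℝ)) (v : Vec3) :
    ∫ z, κ z * (∂_{e} p) (v + z) = - ∫ z, κ' z * p (v + z) := by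
  refine integral_bilinear_hasLineDerivAt_right_eq_neg_left_of_integrable
    (μ := volume) (v := e) (B := ContinuousLinearMap.mul ℝ ℝ) (f := κ) (f' := κ')
    (g := fun z => p (v + z)) (g' := fun z => (∂_{e} p) (v + z))
    (h'.integrable_mul_translate p v) (h.integrable_mul_translate _ v)
    (h.integrable_mul_translate p v) (fun z _ => hd z) (fun z _ => ?_)
  rw [SchwartzMap.lineDerivOp_apply_eq_fderiv]
  have h1 : HasFDerivAt (fun z => p (v + z)) (fderiv ℝ p (v + z)) z :=
    (hasFDerivAt_comp_add_left v).2 (p.hasFDerivAt (v + z))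
  exact h1.hasLineDerivAt e

end BddCont

lemma hasLineDerivAt_mul {f g : Vec3 → ℝ} {f' g' : ℝ} {z e : Vec3}
    (hf : HasLineDerivAt ℝ f f' z e) (hg : HasLineDerivAt ℝ g g' z e) :
    HasLineDerivAt ℝ (fun y => f y * g y) (f' * g z + f z * g') z e := by
  rw [HasLineDerivAt] at *
  refine (HasDerivAt.mul hf hg).congr_deriv ?_
  simp

lemma hasLineDerivAt_coord (z : Vec3) (i j : Fin 3) :
    HasLineDerivAt ℝ (fun y : Vec3 => y i) (if i = j then 1 else 0) z (basisVec j) := by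
  have h : HasFDerivAt (fun y : Vec3 => y i) (EuclideanSpace.proj (𝕜 := ℝ) i) z :=
    (EuclideanSpace.proj (𝕜 := ℝ) i).hasFDerivAt
  have := h.hasLineDerivAt (basisVec j)
  simpa [Pi.single_apply, eq_comm] using this

/-! ### The regularised Coulomb kernel and its double divergence. -/

/-- The regularised inverse distance `(|z|² + ε²)^{-1/2}`. -/
noncomputable def invReg (ε : ℝ) (z : Vec3) : ℝ := (Real.sqrt (‖z‖ ^ 2 + ε ^ 2))⁻¹

section
variable {ε : ℝ} (hε : 0 < ε)
include hε

lemma invReg_pos (z : Vec3) : 0 < invReg ε z := by unfold invReg; positivity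

lemma invReg_sq (z : Vec3) : (z 0 ^ 2 + z 1 ^ 2 + z 2 ^ 2 + ε ^ 2) * invReg ε z ^ 2 = 1 := by
  have h : ‖z‖ ^ 2 = z 0 ^ 2 + z 1 ^ 2 + z 2 ^ 2 := by
    rw [EuclideanSpace.norm_sq_eq, Fin.sum_univ_three]; simp
  rw [← h, invReg, inv_pow, Real.sq_sqrt (by positivity), mul_inv_cancel₀ (by positivity)]

lemma continuous_invReg : Continuous (invReg ε) := by
  unfold invReg
  exact Continuous.inv₀ (by fun_prop) fun z => by positivity

lemma hasLineDerivAt_invReg (z : Vec3) (j : Fin 3) :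
    HasLineDerivAt ℝ (invReg ε) (-(z j * invReg ε z ^ 3)) z (basisVec j) := by
  have h1 : HasDerivAt (fun t : ℝ => ‖z + t • basisVec j‖ ^ 2 + ε ^ 2) (2 * z j) 0 := by
    have h2 : HasDerivAt (fun t : ℝ => z + t • basisVec j) (basisVec j) 0 := by
      simpa using ((hasDerivAt_id (0 : ℝ)).smul_const (basisVec j)).const_add z
    have := (h2.norm_sq).add_const (ε ^ 2)
    simpa [EuclideanSpace.inner_single_right] using this
  have h3 := (h1.sqrt (by positivity)).inv (by positivity)
  rw [HasLineDerivAt]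
  refine h3.congr_deriv ?_
  simp only [zero_smul, add_zero, invReg]
  have hs : 0 < Real.sqrt (‖z‖ ^ 2 + ε ^ 2) := by positivity
  field_simp

lemma bddCont_invReg : BddCont (invReg ε) := by
  refine ⟨continuous_invReg hε, ε⁻¹, fun z => ?_⟩
  rw [abs_of_pos (invReg_pos hε z)]
  refine inv_anti₀ hε (Real.le_sqrt_of_sq_le ?_)
  nlinarith [sq_nonneg ‖z‖]

/-- With `s = invReg ε`, the functions `z i * s` and `s` are the building blocks: the regularised
kernel and the derivatives used below are polynomials in them, hence bounded. -/
lemma bddCont_coord_mul_invReg (i : Fin 3) : BddCont fun z => z i * invReg ε z := by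
  refine ⟨by have := continuous_invReg hε; fun_prop, 1, fun z => ?_⟩
  rw [abs_le_one_iff_mul_self_le_one]
  have h := invReg_sq hε z
  have h0 := sq_nonneg (invReg ε z)
  fin_cases i <;> simp only [Fin.zero_eta, Fin.mk_one, Fin.reduceFinMk] <;>
    nlinarith [mul_nonneg (sq_nonneg (z 0)) h0, mul_nonneg (sq_nonneg (z 1)) h0,
      mul_nonneg (sq_nonneg (z 2)) h0, mul_nonneg (sq_nonneg ε) h0]

end

/-- The Hessian of `(|z|² + ε²)^{1/2}`, a regularisation of `Π(z)/|z|`. -/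
noncomputable def regKernel (ε : ℝ) (i j : Fin 3) (z : Vec3) : ℝ :=
  (if i = j then 1 else 0) * invReg ε z - z i * z j * invReg ε z ^ 3

/-- The derivative of `regKernel ε i j` in the direction `j`. -/
noncomputable def regKernelDeriv (ε : ℝ) (i j : Fin 3) (z : Vec3) : ℝ :=
  -(if i = j then 1 else 0) * (z j * invReg ε z ^ 3)
    - (((if i = j then 1 else 0) * z j + z i) * invReg ε z ^ 3
      + z i * z j * (-(3 * (z j * invReg ε z ^ 5))))

/-- The divergence of the `i`-th row of the regularised kernel. -/
noncomputable def regDrift (ε : ℝ) (i : Fin 3) (z : Vec3) : ℝ :=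
  -5 * (z i * invReg ε z ^ 3) + 3 * (z i * (z 0 ^ 2 + z 1 ^ 2 + z 2 ^ 2) * invReg ε z ^ 5)

/-- The derivative of `regDrift ε i` in the direction `i`. -/
noncomputable def regDriftDeriv (ε : ℝ) (i : Fin 3) (z : Vec3) : ℝ :=
  -5 * invReg ε z ^ 3 + 21 * (z i ^ 2 * invReg ε z ^ 5)
    + 3 * ((z 0 ^ 2 + z 1 ^ 2 + z 2 ^ 2) * invReg ε z ^ 5)
    - 15 * (z i ^ 2 * (z 0 ^ 2 + z 1 ^ 2 + z 2 ^ 2) * invReg ε z ^ 7)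

lemma sum_regKernelDeriv (ε : ℝ) (i : Fin 3) (z : Vec3) :
    ∑ j, regKernelDeriv ε i j z = regDrift ε i z := by
  simp only [regKernelDeriv, regDrift, Fin.sum_univ_three]
  fin_cases i <;> simp <;> ring

/-- Substituting `|z|² s² = 1 - ε² s²` cancels every term of lower order in `ε`. What remains is an
approximate identity up to a constant factor. -/
lemma sum_regDriftDeriv {ε : ℝ} (hε : 0 < ε) (z : Vec3) :
    ∑ i, regDriftDeriv ε i z = -15 * (ε ^ 4 * invReg ε z ^ 7) := by
  simp only [regDriftDeriv, Fin.sum_univ_three]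
  have h := invReg_sq hε z
  set s := invReg ε z
  set N := z 0 ^ 2 + z 1 ^ 2 + z 2 ^ 2 with hN
  have h2 : N * s ^ 2 = 1 - ε ^ 2 * s ^ 2 := by linarith
  have : (-15 : ℝ) * s ^ 3 + 30 * (N * s ^ 2) * s ^ 3 - 15 * (N * s ^ 2) ^ 2 * s ^ 3
      = -15 * (ε ^ 4 * s ^ 7) := by rw [h2]; ring
  rw [← this, hN]; ring

section
variable {ε : ℝ} (hε : 0 < ε)
include hε

lemma bddCont_regKernel (i j : Fin 3) : BddCont (regKernel ε i j) := by
  have hs := bddCont_invReg hε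
  have hi := bddCont_coord_mul_invReg hε i
  have hj := bddCont_coord_mul_invReg hε j
  convert ((BddCont.const (if i = j then 1 else 0)).mul hs).add
    ((BddCont.const (-1)).mul ((hi.mul hj).mul hs)) using 2 with z
  simp only [regKernel]; ring

lemma bddCont_regKernelDeriv (i j : Fin 3) : BddCont (regKernelDeriv ε i j) := by
  have hs := bddCont_invReg hε
  have hi := bddCont_coord_mul_invReg hε i
  have hj := bddCont_coord_mul_invReg hε j
  convert ((BddCont.const (-2 * (if i = j then 1 else 0))).mul ((hj.mul hs).mul hs)).add
    (((BddCont.const (-1)).mul ((hi.mul hs).mul hs)).add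
      ((BddCont.const 3).mul ((((hi.mul hj).mul hj).mul hs).mul hs))) using 2 with z
  simp only [regKernelDeriv]; ring

lemma bddCont_normSq_mul : BddCont fun z => (z 0 ^ 2 + z 1 ^ 2 + z 2 ^ 2) * invReg ε z ^ 2 := by
  have h (i : Fin 3) := bddCont_coord_mul_invReg hε i
  convert (((h 0).mul (h 0)).add ((h 1).mul (h 1))).add ((h 2).mul (h 2)) using 2 with z
  ring

lemma bddCont_regDrift (i : Fin 3) : BddCont (regDrift ε i) := by
  have hs := bddCont_invReg hε
  have hi := bddCont_coord_mul_invReg hε i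
  have hN := bddCont_normSq_mul hε
  convert ((BddCont.const (-5)).mul ((hi.mul hs).mul hs)).add
    ((BddCont.const 3).mul (((hi.mul hN).mul hs).mul hs)) using 2 with z
  simp only [regDrift]; ring

lemma bddCont_regDriftDeriv (i : Fin 3) : BddCont (regDriftDeriv ε i) := by
  have hs := bddCont_invReg hε
  have hs3 := (hs.mul hs).mul hs
  have hi := bddCont_coord_mul_invReg hε i
  have hN := bddCont_normSq_mul hε
  convert (((BddCont.const (-5)).mul hs3).add ((BddCont.const 21).mul ((hi.mul hi).mul hs3))).add
    (((BddCont.const 3).mul (hN.mul hs3)).add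
      ((BddCont.const (-15)).mul (((hi.mul hi).mul hN).mul hs3))) using 2 with z
  simp only [regDriftDeriv]; ring

/-- The exponent `n + 1` avoids truncated subtraction in the power rule. -/
lemma hasLineDerivAt_invReg_pow (z : Vec3) (j : Fin 3) (n : ℕ) :
    HasLineDerivAt ℝ (fun y => invReg ε y ^ (n + 1))
      (-((n + 1) * (z j * invReg ε z ^ (n + 3)))) z (basisVec j) := by
  have h : HasDerivAt _ _ _ := hasLineDerivAt_invReg hε z j
  have := h.pow (n + 1)
  rw [HasLineDerivAt]
  refine this.congr_deriv ?_
  simp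
  ring

lemma hasLineDerivAt_regKernel (i j : Fin 3) (z : Vec3) :
    HasLineDerivAt ℝ (regKernel ε i j) (regKernelDeriv ε i j z) z (basisVec j) := by
  have hs := hasLineDerivAt_invReg hε z j
  have h3 := hasLineDerivAt_invReg_pow hε z j 2
  have hij := hasLineDerivAt_mul (hasLineDerivAt_coord z i j) (hasLineDerivAt_coord z j j)
  have h1 : HasDerivAt _ _ _ := hs
  have h2 : HasDerivAt _ _ _ := hasLineDerivAt_mul hij h3
  have := (h1.const_mul (if i = j then (1 : ℝ) else 0)).sub h2
  rw [HasLineDerivAt]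
  refine this.congr_deriv ?_
  simp only [regKernelDeriv, if_true]
  push_cast
  ring

lemma hasLineDerivAt_regDrift (i : Fin 3) (z : Vec3) :
    HasLineDerivAt ℝ (regDrift ε i) (regDriftDeriv ε i z) z (basisVec i) := by
  have h3 := hasLineDerivAt_invReg_pow hε z i 2
  have h5 := hasLineDerivAt_invReg_pow hε z i 4
  have hc (k : Fin 3) := hasLineDerivAt_coord z k i
  have hN : HasLineDerivAt ℝ (fun y : Vec3 => y 0 ^ 2 + y 1 ^ 2 + y 2 ^ 2) (2 * z i) z
      (basisVec i) := by
    have q (k : Fin 3) : HasDerivAt _ _ _ := hasLineDerivAt_mul (hc k) (hc k)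
    have := ((q 0).add (q 1)).add (q 2)
    rw [HasLineDerivAt]
    convert this using 1
    · ext t; simp; ring
    · fin_cases i <;> simp <;> ring
  have h1 : HasDerivAt _ _ _ := hasLineDerivAt_mul (hc i) h3
  have h2 : HasDerivAt _ _ _ := hasLineDerivAt_mul (hasLineDerivAt_mul (hc i) hN) h5
  have := (h1.const_mul (-5)).add (h2.const_mul 3)
  rw [HasLineDerivAt]
  refine this.congr_deriv ?_
  simp only [regDriftDeriv, if_true]
  push_cast
  ring

/-- Two integrations by parts against the regularised kernel. -/
lemma integral_regKernel_hessian (p : 𝓢(Vec3, ℝ)) (v : Vec3) :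
    ∫ z, ∑ i, ∑ j, regKernel ε i j z * (∂_{basisVec j} (∂_{basisVec i} p)) (v + z)
      = -15 * ∫ z, ε ^ 4 * invReg ε z ^ 7 * p (v + z) := by
  have int1 (i j : Fin 3) := (bddCont_regKernel hε i j).integrable_mul_translate
    (∂_{basisVec j} (∂_{basisVec i} p)) v
  have int2 (i j : Fin 3) := (bddCont_regKernelDeriv hε i j).integrable_mul_translate
    (∂_{basisVec i} p) v
  have int3 (i : Fin 3) := (bddCont_regDriftDeriv hε i).integrable_mul_translate p v
  rw [integral_finsetSum _ fun i _ => integrable_finsetSum _ fun j _ => int1 i j]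
  -- The first integration by parts is in direction `j`; summing over `j` turns the row into its
  -- divergence `regDrift`, and the second is in direction `i`.
  have step (i : Fin 3) :
      ∫ z, ∑ j, regKernel ε i j z * (∂_{basisVec j} (∂_{basisVec i} p)) (v + z)
        = ∫ z, regDriftDeriv ε i z * p (v + z) := by
    rw [integral_finsetSum _ fun j _ => int1 i j]
    simp_rw [fun j => (bddCont_regKernel hε i j).integral_mul_lineDeriv
      (bddCont_regKernelDeriv hε i j) _ (hasLineDerivAt_regKernel hε i j) (∂_{basisVec i} p) v]
    rw [Finset.sum_neg_distrib, ← integral_finsetSum _ fun j _ => int2 i j]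
    simp_rw [← Finset.sum_mul, sum_regKernelDeriv]
    rw [(bddCont_regDrift hε i).integral_mul_lineDeriv (bddCont_regDriftDeriv hε i) _
      (hasLineDerivAt_regDrift hε i) p v, neg_neg]
  simp_rw [step]
  rw [← integral_finsetSum _ fun i _ => int3 i, ← integral_const_mul]
  simp_rw [← Finset.sum_mul, sum_regDriftDeriv hε]
  congr 1; ext z; ring

end

/-! ### The Coulomb kernel as the limit of its regularisations. -/

/-- The entries of the matrix `Π(z) / |z|`. -/
noncomputable def coulombKernel (i j : Fin 3) (z : Vec3) : ℝ :=
  ‖z‖⁻¹ * ((if i = j then 1 else 0) - z i * z j / ‖z‖ ^ 2)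

lemma abs_coord_le_norm (z : Vec3) (i : Fin 3) : |z i| ≤ ‖z‖ := by
  simpa using PiLp.norm_apply_le z i

lemma integrable_norm_inv_mul_translate {F : Type*} [NormedAddCommGroup F] [NormedSpace ℝ F]
    (u : 𝓢(Vec3, F)) (v : Vec3) : Integrable fun z => ‖z‖⁻¹ * ‖u (v + z)‖ := by
  obtain ⟨C, hC, h⟩ := exists_decay_translate u 4 v
  refine Integrable.mono' (integrable_norm_inv_mul_decay.const_mul C) ?_ (.of_forall fun z => ?_)
  · have h1 : Measurable fun z : Vec3 => ‖z‖⁻¹ := by fun_prop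
    have h2 : Continuous fun z : Vec3 => ‖u (v + z)‖ := by fun_prop
    exact h1.aestronglyMeasurable.mul h2.aestronglyMeasurable
  · rw [Real.norm_of_nonneg (by positivity), mul_left_comm]
    exact mul_le_mul_of_nonneg_left (h v (Metric.mem_ball_self one_pos) z) (by positivity)

lemma measurable_coulombKernel (i j : Fin 3) : Measurable (coulombKernel i j) := by
  unfold coulombKernel; fun_prop

lemma abs_delta_sub_le {a b : ℝ} (i j : Fin 3) (ha : |a| ≤ 1) (hb : |b| ≤ 1) :
    |(if i = j then (1 : ℝ) else 0) - a * b| ≤ 2 := by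
  have h1 : |a * b| ≤ 1 := by
    rw [abs_mul]; exact mul_le_one₀ ha (abs_nonneg _) hb
  have h2 : |(if i = j then (1 : ℝ) else 0)| ≤ 1 := by split_ifs <;> simp
  linarith [abs_sub (if i = j then (1 : ℝ) else 0) (a * b)]

lemma abs_coulombKernel_le (i j : Fin 3) (z : Vec3) : |coulombKernel i j z| ≤ 2 * ‖z‖⁻¹ := by
  have h (k : Fin 3) : |z k / ‖z‖| ≤ 1 := by
    rw [abs_div, abs_norm]; exact div_le_one_of_le₀ (abs_coord_le_norm z k) (norm_nonneg z)
  have := abs_delta_sub_le i j (h i) (h j)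
  rw [coulombKernel, abs_mul, abs_of_nonneg (by positivity : 0 ≤ ‖z‖⁻¹), mul_comm]
  refine mul_le_mul_of_nonneg_right ?_ (by positivity)
  rwa [show z i * z j / ‖z‖ ^ 2 = z i / ‖z‖ * (z j / ‖z‖) by ring]

lemma integrable_coulombKernel_mul (i j : Fin 3) (u : 𝓢(Vec3, ℝ)) (v : Vec3) :
    Integrable fun z => coulombKernel i j z * u (v + z) := by
  refine Integrable.mono' ((integrable_norm_inv_mul_translate u v).const_mul 2) ?_
    (.of_forall fun z => ?_)
  · have h2 : Continuous fun z : Vec3 => u (v + z) := by fun_prop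
    exact (measurable_coulombKernel i j).aestronglyMeasurable.mul h2.aestronglyMeasurable
  · rw [norm_mul, ← mul_assoc]
    exact mul_le_mul_of_nonneg_right (abs_coulombKernel_le i j z) (norm_nonneg _)

lemma invReg_le {ε : ℝ} {z : Vec3} (hz : z ≠ 0) : invReg ε z ≤ ‖z‖⁻¹ := by
  refine inv_anti₀ (norm_pos_iff.2 hz) (Real.le_sqrt_of_sq_le ?_)
  nlinarith [sq_nonneg ε]

lemma abs_regKernel_le {ε : ℝ} (hε : 0 < ε) (i j : Fin 3) {z : Vec3} (hz : z ≠ 0) :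
    |regKernel ε i j z| ≤ 2 * ‖z‖⁻¹ := by
  have hs := invReg_pos hε z
  have h (k : Fin 3) : |z k * invReg ε z| ≤ 1 := by
    rw [abs_mul, abs_of_pos hs]
    calc |z k| * invReg ε z ≤ ‖z‖ * ‖z‖⁻¹ :=
          mul_le_mul (abs_coord_le_norm z k) (invReg_le hz) hs.le (norm_nonneg z)
      _ = 1 := mul_inv_cancel₀ (norm_ne_zero_iff.2 hz)
  have h2 := abs_delta_sub_le i j (h i) (h j)
  have : regKernel ε i j z
      = ((if i = j then (1 : ℝ) else 0) - z i * invReg ε z * (z j * invReg ε z)) * invReg ε z := by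
    rw [regKernel]; ring
  rw [this, abs_mul, abs_of_pos hs]
  exact mul_le_mul h2 (invReg_le hz) hs.le zero_le_two

lemma tendsto_regKernel (i j : Fin 3) {z : Vec3} (hz : z ≠ 0) :
    Tendsto (fun ε => regKernel ε i j z) (𝓝[>] 0) (𝓝 (coulombKernel i j z)) := by
  have hz' := norm_pos_iff.2 hz
  have hs : Tendsto (fun ε => invReg ε z) (𝓝 0) (𝓝 ‖z‖⁻¹) := by
    have hc : ContinuousAt (fun ε : ℝ => invReg ε z) 0 := by
      unfold invReg
      refine ContinuousAt.inv₀ (by fun_prop) ?_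
      positivity
    have := hc.tendsto
    simpa [invReg] using this
  have := ((hs.const_mul (if i = j then (1 : ℝ) else 0)).sub
    ((hs.pow 3).const_mul (z i * z j))).mono_left (nhdsWithin_le_nhds (s := Ioi 0))
  have e : coulombKernel i j z
      = (if i = j then (1 : ℝ) else 0) * ‖z‖⁻¹ - z i * z j * ‖z‖⁻¹ ^ 3 := by
    unfold coulombKernel
    field_simp
  rwa [e]

lemma invReg_smul {ε : ℝ} (hε : 0 < ε) (z : Vec3) : invReg ε (ε • z) = ε⁻¹ * invReg 1 z := by
  rw [invReg, invReg, ← mul_inv]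
  congr 1
  rw [norm_smul, Real.norm_of_nonneg hε.le,
    show (ε * ‖z‖) ^ 2 + ε ^ 2 = ε ^ 2 * (‖z‖ ^ 2 + 1 ^ 2) by ring,
    Real.sqrt_mul (by positivity), Real.sqrt_sq hε.le]

lemma integrable_invReg_one_pow : Integrable fun z => invReg 1 z ^ 7 := by
  have := integrable_rpow_neg_one_add_norm_sq (E := Vec3) (μ := volume) (r := 7)
    (by simp; norm_num)
  refine this.congr (.of_forall fun z => ?_)
  simp only [invReg]
  rw [inv_pow, Real.sqrt_eq_rpow, ← Real.rpow_natCast _ 7, ← Real.rpow_mul (by positivity),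
    ← Real.rpow_neg (by positivity), add_comm, one_pow]
  norm_num

lemma integrable_invReg_pow {ε : ℝ} (hε : 0 < ε) :
    Integrable fun z => ε ^ 4 * invReg ε z ^ 7 := by
  rw [← integrable_comp_smul_iff volume _ hε.ne']
  simp_rw [invReg_smul hε, mul_pow]
  exact (integrable_invReg_one_pow.const_mul _).const_mul _

/-- Scaling `z ↦ ε z` produces `ε^4 ε^{-7} = ε^{-3}`, which the Jacobian in dimension three absorbs:
the mass does not depend on `ε`. -/
lemma integral_invReg_pow {ε : ℝ} (hε : 0 < ε) :
    ∫ z, ε ^ 4 * invReg ε z ^ 7 = ∫ z, invReg 1 z ^ 7 := by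
  have h := Measure.integral_comp_smul volume (fun z : Vec3 => ε ^ 4 * invReg ε z ^ 7) ε
  simp only [finrank_euclideanSpace, Fintype.card_fin, smul_eq_mul, invReg_smul hε, mul_pow] at h
  rw [abs_of_pos (by positivity)] at h
  have h2 : ∫ z, ε ^ 4 * (ε⁻¹ ^ 7 * invReg 1 z ^ 7) = (ε ^ 3)⁻¹ * ∫ z, invReg 1 z ^ 7 := by
    rw [← integral_const_mul]
    congr 1; ext z; field_simp
  rw [h2] at h
  exact (mul_left_cancel₀ (by positivity) h).symm

/-- The double divergence of the Coulomb kernel acts as a bounded operator on `L^∞`. -/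
theorem abs_integral_coulombKernel_hessian_le (p : 𝓢(Vec3, ℝ)) {F : ℝ} (hF : ∀ w, |p w| ≤ F)
    (v : Vec3) :
    |∫ z, ∑ i, ∑ j, coulombKernel i j z * (∂_{basisVec j} (∂_{basisVec i} p)) (v + z)|
      ≤ 15 * ((∫ z, invReg 1 z ^ 7) * F) := by
  set H : Fin 3 → Fin 3 → 𝓢(Vec3, ℝ) := fun i j => ∂_{basisVec j} (∂_{basisVec i} p) with hH
  -- Both kernels are dominated by `2/|z|` uniformly in `ε`, so dominated convergence applies; the
  -- bound is then proved for each `ε > 0`.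
  have hlim : Tendsto (fun ε => ∫ z, ∑ i, ∑ j, regKernel ε i j z * H i j (v + z)) (𝓝[>] 0)
      (𝓝 (∫ z, ∑ i, ∑ j, coulombKernel i j z * H i j (v + z))) := by
    refine tendsto_integral_filter_of_dominated_convergence
      (fun z => ∑ i, ∑ j, 2 * (‖z‖⁻¹ * ‖H i j (v + z)‖)) ?_ ?_ ?_ ?_
    · filter_upwards [self_mem_nhdsWithin] with ε hε
      refine Continuous.aestronglyMeasurable ?_
      refine continuous_finsetSum _ fun i _ => continuous_finsetSum _ fun j _ => ?_
      exact (bddCont_regKernel hε i j).1.mul (by fun_prop)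
    · filter_upwards [self_mem_nhdsWithin] with ε hε
      filter_upwards [Measure.ae_ne volume 0] with z hz
      refine (norm_sum_le _ _).trans (Finset.sum_le_sum fun i _ => ?_)
      refine (norm_sum_le _ _).trans (Finset.sum_le_sum fun j _ => ?_)
      rw [norm_mul, ← mul_assoc]
      exact mul_le_mul_of_nonneg_right (abs_regKernel_le hε i j hz) (norm_nonneg _)
    · exact integrable_finsetSum _ fun i _ => integrable_finsetSum _ fun j _ =>
        (integrable_norm_inv_mul_translate (H i j) v).const_mul 2
    · filter_upwards [Measure.ae_ne volume 0] with z hz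
      exact tendsto_finsetSum _ fun i _ => tendsto_finsetSum _ fun j _ =>
        (tendsto_regKernel i j hz).mul_const _
  refine le_of_tendsto hlim.abs ?_
  filter_upwards [self_mem_nhdsWithin] with ε hε
  rw [integral_regKernel_hessian hε, abs_mul]
  simp only [abs_neg, Nat.abs_ofNat]
  refine mul_le_mul_of_nonneg_left ?_ (by norm_num)
  rw [← integral_invReg_pow hε, ← integral_mul_const, ← Real.norm_eq_abs]
  refine norm_integral_le_of_norm_le ((integrable_invReg_pow hε).mul_const F)
    (.of_forall fun z => ?_)
  have := invReg_pos hε z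
  have h0 : 0 ≤ ε ^ 4 * invReg ε z ^ 7 := by positivity
  rw [norm_mul, Real.norm_of_nonneg h0]
  exact mul_le_mul_of_nonneg_left (hF _) h0

/-! ### The collision operator in non-divergence form. -/

/-- Convolution of `u` with the `(i, j)` entry of the Coulomb kernel. -/
noncomputable def coulombConv (i j : Fin 3) (u : 𝓢(Vec3, ℝ)) (v : Vec3) : ℝ :=
  ∫ z, coulombKernel i j z * u (v + z)

/-- The variable `z = w - v` keeps the singularity fixed at the origin, so that differentiation in
`v` falls on the Schwartz function only. -/
lemma hasFDerivAt_coulombConv (i j : Fin 3) (u : 𝓢(Vec3, ℝ)) (v : Vec3) :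
    HasFDerivAt (coulombConv i j u) (∫ z, coulombKernel i j z • fderiv ℝ u (v + z)) v := by
  set u' := SchwartzMap.fderivCLM ℝ Vec3 ℝ u with hu'
  have hu'_apply (w : Vec3) : fderiv ℝ u w = u' w := by simp [hu']
  obtain ⟨C, hC, h⟩ := exists_decay_translate u' 4 v
  have hk := (measurable_coulombKernel i j).aestronglyMeasurable (μ := volume)
  refine hasFDerivAt_integral_of_dominated_of_fderiv_le (Metric.ball_mem_nhds v one_pos)
    (F' := fun w z => coulombKernel i j z • fderiv ℝ u (w + z))
    (bound := fun z => 2 * C * (‖z‖⁻¹ * ((1 + ‖z‖) ^ 4)⁻¹)) ?_ ?_ ?_ ?_ ?_ ?_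
  · refine .of_forall fun w => ?_
    exact hk.mul (Continuous.aestronglyMeasurable (by fun_prop))
  · exact integrable_coulombKernel_mul i j u v
  · simp_rw [hu'_apply]
    exact hk.smul (Continuous.aestronglyMeasurable (by fun_prop))
  · refine .of_forall fun z w hw => ?_
    rw [hu'_apply, norm_smul]
    calc ‖coulombKernel i j z‖ * ‖u' (w + z)‖
        ≤ (2 * ‖z‖⁻¹) * (C * ((1 + ‖z‖) ^ 4)⁻¹) :=
          mul_le_mul (abs_coulombKernel_le i j z) (h w hw z) (norm_nonneg _) (by positivity)
      _ = _ := by ring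
  · exact integrable_norm_inv_mul_decay.const_mul _
  · refine .of_forall fun z w _ => ?_
    have := (hasFDerivAt_comp_add_right z).2 (u.hasFDerivAt (w + z))
    exact this.const_mul _

lemma fderiv_coulombConv_apply (i j : Fin 3) (u : 𝓢(Vec3, ℝ)) (v e : Vec3) :
    fderiv ℝ (coulombConv i j u) v e = coulombConv i j (∂_{e} u) v := by
  rw [(hasFDerivAt_coulombConv i j u v).fderiv, ContinuousLinearMap.integral_apply]
  · simp [coulombConv, SchwartzMap.lineDerivOp_apply_eq_fderiv]
  · have h := integrable_norm_inv_mul_translate (SchwartzMap.fderivCLM ℝ Vec3 ℝ u) v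
    refine (h.const_mul 2).mono' ?_ (.of_forall fun z => ?_)
    · have : Continuous fun z => fderiv ℝ u (v + z) := by
        have : Continuous fun z => SchwartzMap.fderivCLM ℝ Vec3 ℝ u (v + z) := by fun_prop
        simpa using this
      exact (measurable_coulombKernel i j).aestronglyMeasurable.smul this.aestronglyMeasurable
    · rw [norm_smul, SchwartzMap.fderivCLM_apply, ← mul_assoc]
      exact mul_le_mul_of_nonneg_right (abs_coulombKernel_le i j z) (norm_nonneg _)

lemma gradient_apply (p : 𝓢(Vec3, ℝ)) (w : Vec3) (i : Fin 3) :
    gradient p w i = (∂_{basisVec i} p) w := by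
  rw [SchwartzMap.lineDerivOp_apply_eq_fderiv, ← InnerProductSpace.toDual_symm_apply,
    EuclideanSpace.inner_single_right]
  simp [gradient]

lemma flux_integrand_apply (p : 𝓢(Vec3, ℝ)) (v z : Vec3) (i : Fin 3) :
    (‖v - (v + z)‖⁻¹ • Proj (v - (v + z)) (p (v + z) • gradient p v - p v • gradient p (v + z))) i
      = ∑ j, (coulombKernel i j z * p (v + z) * (∂_{basisVec j} p) v
        - p v * (coulombKernel i j z * (∂_{basisVec j} p) (v + z))) := by
  have e : v - (v + z) = -z := by abel
  simp only [e, Proj, norm_neg, PiLp.smul_apply, PiLp.sub_apply, PiLp.neg_apply, smul_eq_mul,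
    PiLp.inner_apply, gradient_apply, coulombKernel, Fin.sum_univ_three, RCLike.inner_apply,
    conj_trivial]
  fin_cases i <;> simp <;> ring

lemma flux_apply (p : 𝓢(Vec3, ℝ)) (v : Vec3) (i : Fin 3) :
    flux p v i = (1 / (8 * Real.pi)) * ∑ j, (coulombConv i j p v * (∂_{basisVec j} p) v
      - p v * coulombConv i j (∂_{basisVec j} p) v) := by
  have int1 (i j : Fin 3) : Integrable fun z =>
      coulombKernel i j z * p (v + z) * (∂_{basisVec j} p) v :=
    (integrable_coulombKernel_mul i j p v).mul_const _
  have int2 (i j : Fin 3) : Integrable fun z =>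
      p v * (coulombKernel i j z * (∂_{basisVec j} p) (v + z)) :=
    (integrable_coulombKernel_mul i j _ v).const_mul _
  have int12 (i j : Fin 3) : Integrable fun z =>
      coulombKernel i j z * p (v + z) * (∂_{basisVec j} p) v
        - p v * (coulombKernel i j z * (∂_{basisVec j} p) (v + z)) := (int1 i j).sub (int2 i j)
  rw [flux, ← integral_add_left_eq_self _ v, PiLp.smul_apply, smul_eq_mul, eval_integral_piLp]
  · simp_rw [flux_integrand_apply]
    rw [integral_finsetSum _ fun j _ => int12 i j]
    congr 2; ext j
    rw [integral_sub (int1 i j) (int2 i j), integral_mul_const, integral_const_mul]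
    rfl
  · intro i
    simp_rw [flux_integrand_apply]
    exact integrable_finsetSum _ fun j _ => int12 i j

lemma divergence_eq_sum {J : Vec3 → Vec3} {v : Vec3}
    (h : ∀ i, DifferentiableAt ℝ (fun w => J w i) v) :
    divergence J v = ∑ i, fderiv ℝ (fun w => J w i) v (basisVec i) := by
  have hJ : DifferentiableAt ℝ J v := differentiableAt_euclidean.2 h
  refine Finset.sum_congr rfl fun i _ => ?_
  have := ((EuclideanSpace.proj (𝕜 := ℝ) (ι := Fin 3) i).hasFDerivAt.comp v
    hJ.hasFDerivAt).fderiv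
  have h2 : fderiv ℝ (fun w => J w i) v = _ := this
  rw [h2]; rfl

lemma coulombKernel_symm (i j : Fin 3) (z : Vec3) : coulombKernel i j z = coulombKernel j i z := by
  simp only [coulombKernel, eq_comm (a := i), mul_comm (z i)]

/-- The collision operator in non-divergence form, up to the value of the double divergence of
the kernel. -/
theorem collision_eq (p : 𝓢(Vec3, ℝ)) (v : Vec3) :
    collision p v = (1 / (8 * Real.pi)) *
      ((∑ i, ∑ j, coulombConv i j p v * (∂_{basisVec j} (∂_{basisVec i} p)) v)
        - p v * ∑ i, ∑ j, coulombConv i j (∂_{basisVec j} (∂_{basisVec i} p)) v) := by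
  have hfl (i : Fin 3) : (fun w => flux p w i) = fun w => (1 / (8 * Real.pi)) *
      ∑ j, (coulombConv i j p w * (∂_{basisVec j} p) w
      - p w * coulombConv i j (∂_{basisVec j} p) w) := funext fun w => flux_apply p w i
  have hder (i : Fin 3) : HasFDerivAt (fun w => flux p w i) ((1 / (8 * Real.pi)) •
      ∑ j, ((coulombConv i j p v • fderiv ℝ ((∂_{basisVec j} p : 𝓢(Vec3, ℝ)) : Vec3 → ℝ) v
          + (∂_{basisVec j} p) v • fderiv ℝ (coulombConv i j p) v)
        - (p v • fderiv ℝ (coulombConv i j (∂_{basisVec j} p)) v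
          + coulombConv i j (∂_{basisVec j} p) v • fderiv ℝ p v))) v := by
    rw [hfl]
    refine HasFDerivAt.const_mul (HasFDerivAt.fun_sum fun j _ => HasFDerivAt.sub ?_ ?_) _
    · exact (hasFDerivAt_coulombConv i j p v).differentiableAt.hasFDerivAt.mul
        ((∂_{basisVec j} p).hasFDerivAt v)
    · exact (p.hasFDerivAt v).mul
        (hasFDerivAt_coulombConv i j (∂_{basisVec j} p) v).differentiableAt.hasFDerivAt
  have hsymm (i j : Fin 3) (u : 𝓢(Vec3, ℝ)) : coulombConv i j u v = coulombConv j i u v := by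
    simp only [coulombConv, coulombKernel_symm i j]
  rw [show collision p v = divergence (flux p) v from rfl,
    divergence_eq_sum fun i => (hder i).differentiableAt]
  simp_rw [fun i => (hder i).fderiv]
  simp only [Fin.sum_univ_three, smul_apply, add_apply,
    sub_apply, smul_eq_mul, fderiv_coulombConv_apply,
    ← SchwartzMap.lineDerivOp_apply_eq_fderiv]
  -- By symmetry of the kernel the first-order products `a_ij[∂_i p] ∂_j p` and `∂_i p a_ij[∂_j p]`
  -- cancel in the double sum.
  simp only [hsymm 1 0, hsymm 2 0, hsymm 2 1]
  ring

/-! ### The collision operator at a contact point with the barrier. -/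

/-- The necessary second order condition at a maximum. -/
lemma second_deriv_nonpos_of_max {f f' : ℝ → ℝ} {f'' a : ℝ} (hf : ∀ s, HasDerivAt f (f' s) s)
    (hf' : HasDerivAt f' f'' a) (hmax : ∀ s, f s ≤ f a) : f'' ≤ 0 := by
  by_contra! hpos
  have hd : deriv f = f' := funext fun s => (hf s).deriv
  have hdd : deriv (deriv f) a = f'' := by rw [hd]; exact hf'.deriv
  have hd0 : deriv f a = 0 := IsLocalMax.deriv_eq_zero (.of_forall hmax)
  -- A positive second derivative would make `a` a local minimum as well; then `f` is constant near
  -- `a` and the second derivative vanishes.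
  have hmin := isLocalMin_of_deriv_deriv_pos (by rw [hdd]; exact hpos) hd0 (hf a).continuousAt
  have hconst : f =ᶠ[𝓝 a] fun _ => f a := hmin.mono fun s hs => le_antisymm (hmax s) hs
  have : deriv (deriv f) a = 0 := by
    rw [hconst.deriv.deriv_eq]; simp
  linarith

lemma bracket_sq (v : Vec3) : bracket v ^ 2 = 1 + ‖v‖ ^ 2 := Real.sq_sqrt (by positivity)

lemma bracket_pos (v : Vec3) : 0 < bracket v := by unfold bracket; positivity

lemma norm_le_bracket (v : Vec3) : ‖v‖ ≤ bracket v :=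
  Real.le_sqrt_of_sq_le (by linarith)

lemma bracket_le (v : Vec3) : bracket v ≤ 1 + ‖v‖ := by
  rw [bracket, Real.sqrt_le_left (by positivity)]
  nlinarith [norm_nonneg v]

lemma continuous_bracket : Continuous bracket := by unfold bracket; fun_prop

lemma bracket_rpow (v : Vec3) (a : ℝ) : bracket v ^ a = (1 + ‖v‖ ^ 2) ^ (a / 2) := by
  rw [bracket, Real.sqrt_eq_rpow, ← Real.rpow_mul (by positivity)]
  ring_nf

lemma lineDeriv_eq_sum (u : 𝓢(Vec3, ℝ)) (w y : Vec3) :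
    fderiv ℝ u w y = ∑ i, y i * (∂_{basisVec i} u) w := by
  have hy : y = ∑ i, y i • basisVec i := by
    ext k; fin_cases k <;> simp [Fin.sum_univ_three]
  conv_lhs => rw [hy]
  simp [SchwartzMap.lineDerivOp_apply_eq_fderiv]

/-- At a contact point with a multiple of `⟨v⟩^{-m}` from below, the Hessian is bounded above. -/
lemma hessian_le_of_touching {m : ℝ} (hm : 0 ≤ m) (p : 𝓢(Vec3, ℝ)) {G : ℝ} (hG : 0 ≤ G) {v : Vec3}
    (hle : ∀ w, p w ≤ G * bracket w ^ (-m)) (heq : p v = G * bracket v ^ (-m)) (y : Vec3) :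
    ∑ i, y i * ∑ j, y j * (∂_{basisVec j} (∂_{basisVec i} p)) v
      ≤ m * (m + 2) * p v / (1 + ‖v‖ ^ 2) * ‖y‖ ^ 2 := by
  set P : ℝ → ℝ := fun s => 1 + ‖v + s • y‖ ^ 2 with hP
  set P' : ℝ → ℝ := fun s => 2 * inner ℝ (v + s • y) y with hP'
  have hline (s : ℝ) : HasDerivAt (fun s : ℝ => v + s • y) y s := by
    simpa using ((hasDerivAt_id s).smul_const y).const_add v
  have hPpos (s : ℝ) : 0 < P s := by simp only [hP]; positivity
  have dP (s : ℝ) : HasDerivAt P (P' s) s := (hline s).norm_sq.const_add 1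
  have dP' : HasDerivAt P' (2 * ‖y‖ ^ 2) 0 := by
    have := ((hline 0).inner ℝ (hasDerivAt_const 0 y)).const_mul 2
    simpa using this
  have dB (s : ℝ) : HasDerivAt (fun s => P s ^ (-m / 2)) (P' s * (-m / 2) * P s ^ (-m / 2 - 1)) s :=
    (dP s).rpow_const (Or.inl (hPpos s).ne')
  have dB' := (dP'.mul_const (-m / 2)).mul
    ((dP 0).rpow_const (p := -m / 2 - 1) (Or.inl (hPpos 0).ne'))
  have du (u : 𝓢(Vec3, ℝ)) (s : ℝ) : HasDerivAt (fun s : ℝ => u (v + s • y))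
      (∑ i, y i * (∂_{basisVec i} u) (v + s • y)) s := by
    rw [← lineDeriv_eq_sum]
    exact (u.hasFDerivAt _).comp_hasDerivAt s (hline s)
  -- On the line through `v` in direction `y`, density minus barrier is maximal at `s = 0`.
  have dφ (s : ℝ) := (du p s).sub ((dB s).const_mul G)
  have dφ' := (HasDerivAt.fun_sum (u := Finset.univ) fun i _ =>
    (du (∂_{basisVec i} p) 0).const_mul (y i)).sub (dB'.const_mul G)
  have key := second_deriv_nonpos_of_max dφ dφ' fun s => by
    have h1 := hle (v + s • y)
    simp only [Pi.sub_apply, hP, zero_smul, add_zero]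
    rw [bracket_rpow] at h1 heq
    linarith
  simp only [zero_smul, add_zero] at key
  have hP0 : P 0 = 1 + ‖v‖ ^ 2 := by simp [hP]
  have hP'0 : P' 0 = 2 * inner ℝ v y := by simp [hP']
  have hpos : 0 < 1 + ‖v‖ ^ 2 := by positivity
  rw [hP0, hP'0] at key
  rw [bracket_rpow] at heq
  have e1 : (1 + ‖v‖ ^ 2) ^ (-m / 2 - 1) = (1 + ‖v‖ ^ 2) ^ (-m / 2) / (1 + ‖v‖ ^ 2) :=
    Real.rpow_sub_one hpos.ne' _
  have e2 : (1 + ‖v‖ ^ 2) ^ (-m / 2 - 1 - 1)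
      = (1 + ‖v‖ ^ 2) ^ (-m / 2) / (1 + ‖v‖ ^ 2) / (1 + ‖v‖ ^ 2) := by
    rw [Real.rpow_sub_one hpos.ne', e1]
  rw [e1, e2] at key
  refine (sub_nonpos.1 key).trans ?_
  rw [heq]
  set Q := 1 + ‖v‖ ^ 2
  set b := Q ^ (-m / 2)
  have hb : 0 < b := Real.rpow_pos_of_pos hpos _
  have hcs : (inner ℝ v y) ^ 2 ≤ Q * ‖y‖ ^ 2 := by
    have h1 := real_inner_mul_inner_self_le v y
    rw [real_inner_self_eq_norm_sq, real_inner_self_eq_norm_sq] at h1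
    have : 0 ≤ ‖y‖ ^ 2 := by positivity
    simp only [Q]; nlinarith
  have e3 : G * (2 * ‖y‖ ^ 2 * (-m / 2) * (b / Q) +
      2 * inner ℝ v y * (-m / 2) * (2 * inner ℝ v y * (-m / 2 - 1) * (b / Q / Q)))
      = G * (b / Q) * (m * (m + 2) * (inner ℝ v y ^ 2 / Q) - m * ‖y‖ ^ 2) := by
    field_simp; ring
  have e4 : m * (m + 2) * (G * b) / Q * ‖y‖ ^ 2 = G * (b / Q) * (m * (m + 2) * ‖y‖ ^ 2) := by
    ring
  rw [e3, e4]
  have hdiv : inner ℝ v y ^ 2 / Q ≤ ‖y‖ ^ 2 := by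
    rw [div_le_iff₀ hpos, mul_comm]; exact hcs
  refine mul_le_mul_of_nonneg_left ?_ (by positivity)
  -- Cauchy–Schwarz bounds the radial part of the barrier's Hessian; the remaining part `-m ‖y‖²` is
  -- discarded.
  have h5 := mul_le_mul_of_nonneg_left hdiv (by positivity : 0 ≤ m * (m + 2))
  have : 0 ≤ m * ‖y‖ ^ 2 := by positivity
  linarith

/-- The contraction of `Π(z)/|z|` with a matrix whose quadratic form is bounded above. -/
lemma sum_coulombKernel_mul_le {A : Fin 3 → Fin 3 → ℝ} {Λ : ℝ}
    (hA : ∀ y : Vec3, ∑ i, y i * ∑ j, y j * A i j ≤ Λ * ‖y‖ ^ 2) (z : Vec3) :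
    ∑ i, ∑ j, coulombKernel i j z * A i j ≤ 2 * Λ * ‖z‖⁻¹ := by
  rcases eq_or_ne z 0 with rfl | hz
  · simp [coulombKernel]
  have hz' := norm_pos_iff.2 hz
  have hn : (z 0 / ‖z‖) ^ 2 + (z 1 / ‖z‖) ^ 2 + (z 2 / ‖z‖) ^ 2 = 1 := by
    have h : ‖z‖ ^ 2 = z 0 ^ 2 + z 1 ^ 2 + z 2 ^ 2 := by
      rw [EuclideanSpace.norm_sq_eq, Fin.sum_univ_three]; simp
    field_simp; exact h.symm
  have hk (i j : Fin 3) : coulombKernel i j z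
      = ‖z‖⁻¹ * ((if i = j then 1 else 0) - z i / ‖z‖ * (z j / ‖z‖)) := by
    rw [coulombKernel]; ring
  simp_rw [hk]
  have hy (a b c : ℝ) : a * (a * A 0 0 + b * A 0 1 + c * A 0 2)
      + b * (a * A 1 0 + b * A 1 1 + c * A 1 2)
      + c * (a * A 2 0 + b * A 2 1 + c * A 2 2) ≤ Λ * (a ^ 2 + b ^ 2 + c ^ 2) := by
    have h := hA !₂[a, b, c]
    rw [EuclideanSpace.norm_sq_eq] at h
    simp only [Fin.sum_univ_three, Real.norm_eq_abs, sq_abs] at h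
    exact h
  have hz0 : 0 ≤ ‖z‖⁻¹ := by positivity
  simp_rw [mul_assoc ‖z‖⁻¹, ← Finset.mul_sum]
  rw [mul_comm _ ‖z‖⁻¹]
  refine mul_le_mul_of_nonneg_left ?_ hz0
  simp only [Fin.sum_univ_three]
  clear hk hA
  generalize z 0 / ‖z‖ = a at hn ⊢
  generalize z 1 / ‖z‖ = b at hn ⊢
  generalize z 2 / ‖z‖ = c at hn ⊢
  -- The quadratic form is evaluated at the three rows of `Π = Id - n ⊗ n`, where `n = z/|z|`. The
  -- values add up to `tr(Π A Π) = tr(Π A)`, and the squared lengths of the rows to `tr Π = 2`.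
  have h := add_le_add (add_le_add (hy (1 - a * a) (-(a * b)) (-(a * c)))
    (hy (-(b * a)) (1 - b * b) (-(b * c)))) (hy (-(c * a)) (-(c * b)) (1 - c * c))
  have e1 : 3 - 2 * (a ^ 2 + b ^ 2 + c ^ 2) + (a ^ 2 + b ^ 2 + c ^ 2) ^ 2 = 2 := by rw [hn]; ring
  have h' : _ ≤ (3 - 2 * (a ^ 2 + b ^ 2 + c ^ 2) + (a ^ 2 + b ^ 2 + c ^ 2) ^ 2) * Λ :=
    h.trans (le_of_eq (by ring))
  rw [e1] at h'
  refine le_trans (le_of_eq ?_) h'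
  simp
  linear_combination (-(a * (a * A 0 0 + b * A 0 1 + c * A 0 2)
    + b * (a * A 1 0 + b * A 1 1 + c * A 1 2) + c * (a * A 2 0 + b * A 2 1 + c * A 2 2))) * hn

/-- Split at `|z| = R = 2⟨v⟩`. Inside, `p ≤ F`. Outside, `⟨v+z⟩ ≥ |z|/2`, and contact at `v` forces
`G ≤ F ⟨v⟩^m`, so the barrier gives `p(v+z) ≤ F (|z|/R)^{-m}`. Rescaling by `R` yields the factor
`R² = 4⟨v⟩²`. -/
lemma integral_norm_inv_mul_le {m : ℝ} (hm : 2 < m) (p : 𝓢(Vec3, ℝ)) {F G : ℝ} {v : Vec3}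
    (h0 : ∀ w, 0 ≤ p w) (hF : ∀ w, p w ≤ F)
    (hle : ∀ w, p w ≤ G * bracket w ^ (-m)) (heq : p v = G * bracket v ^ (-m)) :
    ∫ z, ‖z‖⁻¹ * p (v + z) ≤ 4 * (1 + ‖v‖ ^ 2) * F * ∫ z, tailWeight m z := by
  have hb := bracket_pos v
  set R := 2 * bracket v with hR
  have hRpos : 0 < R := by positivity
  have hF0 : 0 ≤ F := (h0 0).trans (hF 0)
  have hG : G ≤ F * bracket v ^ m := by
    have := hF v
    rw [heq, Real.rpow_neg hb.le, ← div_eq_mul_inv, div_le_iff₀ (by positivity)] at this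
    exact this
  have hpt (z : Vec3) : ‖z‖⁻¹ * p (v + z) ≤ F * R⁻¹ * tailWeight m (R⁻¹ • z) := by
    rcases eq_or_ne z 0 with rfl | hz
    · simp [tailWeight]
    have hz' := norm_pos_iff.2 hz
    have hnorm : ‖R⁻¹ • z‖ = ‖z‖ / R := by
      rw [norm_smul, Real.norm_of_nonneg (by positivity), inv_mul_eq_div]
    have e : F * R⁻¹ * tailWeight m (R⁻¹ • z) = ‖z‖⁻¹ * (F * min 1 ((‖z‖ / R) ^ (-m))) := by
      rw [tailWeight, hnorm]; field_simp
    rw [e]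
    refine mul_le_mul_of_nonneg_left ?_ (by positivity)
    rw [mul_min_of_nonneg _ _ hF0, mul_one]
    refine le_min (hF _) ?_
    rcases le_or_gt ‖z‖ R with h | h
    · have : 1 ≤ (‖z‖ / R) ^ (-m) :=
        Real.one_le_rpow_of_pos_of_le_one_of_nonpos (by positivity)
          (div_le_one_of_le₀ h hRpos.le) (by linarith)
      nlinarith [hF (v + z)]
    · have h1 : ‖z‖ / 2 ≤ bracket (v + z) := by
        have a1 := norm_le_bracket v
        have a2 := norm_le_bracket (v + z)
        have a3 : ‖z‖ ≤ ‖v + z‖ + ‖v‖ := by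
          simpa [add_sub_cancel_left] using norm_sub_le (v + z) v
        linarith
      calc p (v + z) ≤ G * bracket (v + z) ^ (-m) := hle _
        _ ≤ F * bracket v ^ m * (‖z‖ / 2) ^ (-m) := by
            refine mul_le_mul hG ?_ (by have := bracket_pos (v + z); positivity) (by positivity)
            exact Real.rpow_le_rpow_of_nonpos (by positivity) h1 (by linarith)
        _ = F * (‖z‖ / R) ^ (-m) := by
            rw [mul_assoc]
            congr 1
            rw [hR, show ‖z‖ / (2 * bracket v) = (‖z‖ / 2) * (bracket v)⁻¹ by field_simp,
              Real.mul_rpow (by positivity) (by positivity), Real.inv_rpow hb.le,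
              Real.rpow_neg hb.le, inv_inv, mul_comm]
  have hint : Integrable fun z : Vec3 => tailWeight m (R⁻¹ • z) :=
    (integrable_comp_smul_iff volume _ (by positivity)).2 (integrable_tailWeight hm)
  have hint1 : Integrable fun z : Vec3 => ‖z‖⁻¹ * p (v + z) := by
    refine (integrable_norm_inv_mul_translate p v).congr (.of_forall fun z => ?_)
    simp only [Real.norm_of_nonneg (h0 _)]
  refine (integral_mono hint1 (hint.const_mul _) hpt).trans (le_of_eq ?_)
  rw [integral_const_mul, Measure.integral_comp_inv_smul_of_nonneg _ _ hRpos.le,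
    finrank_euclideanSpace, Fintype.card_fin, smul_eq_mul, ← bracket_sq, hR]
  field_simp
  ring

/-- The collision operator at a contact point with a multiple of `⟨v⟩^{-m}` from below. -/
theorem exists_collision_le {m : ℝ} (hm : 2 < m) : ∃ K, ∀ (p : 𝓢(Vec3, ℝ)) (F G : ℝ) (v : Vec3),
    (∀ w, 0 ≤ p w) → (∀ w, p w ≤ F) → (∀ w, p w ≤ G * bracket w ^ (-m)) →
    p v = G * bracket v ^ (-m) → collision p v ≤ K * F * p v := by
  -- The first summand is `2Λ · 4⟨v⟩²` with `Λ = m(m+2) p(v)/⟨v⟩²`, up to the factor `p(v)`; the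
  -- second bounds the double divergence of the kernel.
  refine ⟨1 / (8 * Real.pi) * (8 * (m * (m + 2)) * (∫ z, tailWeight m z)
    + 15 * ∫ z, invReg 1 z ^ 7), fun p F G v h0 hF hle heq => ?_⟩
  have hb := bracket_pos v
  have hF0 : 0 ≤ F := (h0 0).trans (hF 0)
  have hG : 0 ≤ G := by
    have h := h0 v
    rw [heq] at h
    exact nonneg_of_mul_nonneg_left h (by positivity)
  set Λ := m * (m + 2) * p v / (1 + ‖v‖ ^ 2) with hΛ
  have hΛ0 : 0 ≤ Λ := by have := h0 v; positivity
  set H : Fin 3 → Fin 3 → 𝓢(Vec3, ℝ) := fun i j => ∂_{basisVec j} (∂_{basisVec i} p)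
  have hess := hessian_le_of_touching (by linarith : 0 ≤ m) p hG hle heq
  have part1 : ∑ i, ∑ j, coulombConv i j p v * H i j v
      ≤ 8 * (m * (m + 2)) * (∫ z, tailWeight m z) * F * p v := by
    have hi (i j : Fin 3) : Integrable fun z => coulombKernel i j z * p (v + z) * H i j v :=
      (integrable_coulombKernel_mul i j p v).mul_const _
    have e : ∑ i, ∑ j, coulombConv i j p v * H i j v
        = ∫ z, p (v + z) * ∑ i, ∑ j, coulombKernel i j z * H i j v := by
      simp_rw [coulombConv, ← integral_mul_const]
      simp_rw [← integral_finsetSum Finset.univ fun j _ => hi _ j]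
      rw [← integral_finsetSum _ fun i _ => integrable_finsetSum _ fun j _ => hi i j]
      congr 1; ext z
      simp_rw [Finset.mul_sum]
      refine Finset.sum_congr rfl fun i _ => Finset.sum_congr rfl fun j _ => by ring
    have hi1 : Integrable fun z => p (v + z) * ∑ i, ∑ j, coulombKernel i j z * H i j v := by
      refine (integrable_finsetSum Finset.univ fun i _ =>
        integrable_finsetSum Finset.univ fun j _ => hi i j).congr (.of_forall fun z => ?_)
      simp_rw [Finset.mul_sum]
      refine Finset.sum_congr rfl fun i _ => Finset.sum_congr rfl fun j _ => by ring
    have hi2 : Integrable fun z : Vec3 => ‖z‖⁻¹ * p (v + z) := by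
      refine (integrable_norm_inv_mul_translate p v).congr (.of_forall fun z => ?_)
      simp only [Real.norm_of_nonneg (h0 _)]
    rw [e]
    calc ∫ z, p (v + z) * ∑ i, ∑ j, coulombKernel i j z * H i j v
        ≤ ∫ z, 2 * Λ * (‖z‖⁻¹ * p (v + z)) := by
          refine integral_mono hi1 (hi2.const_mul _) fun z => ?_
          have := mul_le_mul_of_nonneg_left (sum_coulombKernel_mul_le hess z) (h0 (v + z))
          simp only [H]
          linarith
      _ = 2 * Λ * ∫ z, ‖z‖⁻¹ * p (v + z) := integral_const_mul _ _
      _ ≤ 2 * Λ * (4 * (1 + ‖v‖ ^ 2) * F * ∫ z, tailWeight m z) :=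
          mul_le_mul_of_nonneg_left (integral_norm_inv_mul_le hm p h0 hF hle heq) (by positivity)
      _ = _ := by rw [hΛ]; field_simp; ring
  have part2 : |∑ i, ∑ j, coulombConv i j (H i j) v| ≤ 15 * ((∫ z, invReg 1 z ^ 7) * F) := by
    have hi (i j : Fin 3) := integrable_coulombKernel_mul i j (H i j) v
    have := abs_integral_coulombKernel_hessian_le p
      (fun w => by rw [abs_of_nonneg (h0 w)]; exact hF w) v
    rw [integral_finsetSum _ fun i _ => integrable_finsetSum _ fun j _ => hi i j] at this
    simp_rw [fun i => integral_finsetSum Finset.univ fun j _ => hi i j] at this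
    exact this
  rw [collision_eq, mul_assoc (1 / (8 * Real.pi)), mul_assoc (1 / (8 * Real.pi))]
  refine mul_le_mul_of_nonneg_left ?_ (by positivity)
  have h2 := mul_le_mul_of_nonneg_left (neg_le_of_abs_le part2) (h0 v)
  simp only [H] at part1 h2
  linarith

/-! ### Consequences of smoothness and rapid decay. -/

section
variable {X : Type} [NormedAddCommGroup X] {cover : Vec3 → X} {T : ℝ} {f : ℝ → X → Vec3 → ℝ}

lemma uniqueDiffOn_slab {a b : ℝ} (h : a < b) :
    UniqueDiffOn ℝ (Icc a b ×ˢ (univ : Set (Vec3 × Vec3))) :=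
  (uniqueDiffOn_Icc h).prod uniqueDiffOn_univ

open scoped Pointwise in
/-- Velocity slices are Schwartz functions. -/
lemma SmoothRapidlyDecaying.exists_schwartz (hf : SmoothRapidlyDecaying cover T f) (hT : 0 < T)
    {t : ℝ} (ht : t ∈ Icc 0 T) (x : Vec3) : ∃ p : 𝓢(Vec3, ℝ), ⇑p = f t (cover x) := by
  set a : ℝ × Vec3 × Vec3 := (t, x, 0)
  set S : Set (ℝ × Vec3 × Vec3) := Icc 0 T ×ˢ univ
  set S' : Set (ℝ × Vec3 × Vec3) := Icc (-t) (T - t) ×ˢ univ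
  set g : Vec3 →L[ℝ] ℝ × Vec3 × Vec3 :=
    (ContinuousLinearMap.inr ℝ ℝ (Vec3 × Vec3)).comp (ContinuousLinearMap.inr ℝ Vec3 Vec3)
  set ψ : ℝ × Vec3 × Vec3 → ℝ := fun q => lift cover f (a + q) with hψ
  -- The affine map `v ↦ (t, x, v)` is the linear injection `g` followed by translation by `a`; the
  -- time slab is translated accordingly.
  have hS : a +ᵥ S' = S := by
    ext q
    rw [mem_vadd_set_iff_neg_vadd_mem]
    simp only [a, S, S', mem_prod, mem_univ, and_true, vadd_eq_add, Prod.fst_add, Prod.fst_neg,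
      mem_Icc]
    constructor <;> rintro ⟨h1, h2⟩ <;> constructor <;> linarith
  have hmaps : MapsTo (fun q => a + q) S' S := fun q hq => by
    rw [← hS]; exact vadd_mem_vadd_set hq
  have hψs : ContDiffOn ℝ ∞ ψ S' := hf.smooth.comp (by fun_prop) hmaps
  have hpre : g ⁻¹' S' = univ := by
    ext v
    simp [g, S', ht.1, ht.2]
  have hcomp : f t (cover x) = ψ ∘ g := by
    ext v; simp [hψ, a, g, lift]
  have hsmooth : ContDiff ℝ ∞ (f t (cover x)) := by
    rw [hcomp, ← contDiffOn_univ, ← hpre]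
    exact hψs.comp_continuousLinearMap g
  have hS'u : UniqueDiffOn ℝ S' := uniqueDiffOn_slab (by linarith)
  refine ⟨⟨f t (cover x), hsmooth, fun k n => ?_⟩, rfl⟩
  obtain ⟨C, hC⟩ := hf.decay n k
  refine ⟨C * ‖g‖ ^ n, fun v => ?_⟩
  have hv : g v ∈ S' := by
    rw [← mem_preimage, hpre]; trivial
  have h1 : iteratedFDeriv ℝ n (f t (cover x)) v
      = (iteratedFDerivWithin ℝ n (lift cover f) S (t, x, v)).compContinuousLinearMap
        fun _ => g := by
    have h2 := g.iteratedFDerivWithin_comp_right hψs hS'u (by rw [hpre]; exact uniqueDiffOn_univ)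
      hv (i := n) (mod_cast le_top)
    rw [hpre, iteratedFDerivWithin_univ, ← hcomp, hψ, iteratedFDerivWithin_comp_add_left, hS] at h2
    simpa [a, g] using h2
  rw [h1]
  have h3 := ContinuousMultilinearMap.norm_compContinuousLinearMap_le
    (iteratedFDerivWithin ℝ n (lift cover f) S (t, x, v)) fun _ => g
  rw [Finset.prod_const, Finset.card_univ, Fintype.card_fin] at h3
  calc _ ≤ (1 + ‖cover x‖ + ‖v‖) ^ k *
        (‖iteratedFDerivWithin ℝ n (lift cover f) S (t, x, v)‖ * ‖g‖ ^ n) := by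
        gcongr
        linarith [norm_nonneg (cover x)]
    _ ≤ C * ‖g‖ ^ n := by
        rw [← mul_assoc]
        gcongr
        exact hC t ht x v

lemma SmoothRapidlyDecaying.exists_lipschitz (hf : SmoothRapidlyDecaying cover T f) (hT : 0 < T) :
    ∃ L, ∀ s ∈ Icc 0 T, ∀ t ∈ Icc 0 T, ∀ x v,
      |f t (cover x) v - f s (cover x) v| ≤ L * |t - s| := by
  obtain ⟨L, hL⟩ := hf.decay 1 0
  refine ⟨L, fun s hs t ht x v => ?_⟩
  have hu := uniqueDiffOn_slab hT
  have hb : ∀ q ∈ Icc 0 T ×ˢ (univ : Set (Vec3 × Vec3)),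
      ‖fderivWithin ℝ (lift cover f) (Icc 0 T ×ˢ univ) q‖ ≤ L := fun q hq => by
    rw [← norm_iteratedFDerivWithin_one _ (hu q hq)]
    simpa using hL q.1 hq.1 q.2.1 q.2.2
  have := ((convex_Icc (0 : ℝ) T).prod convex_univ).norm_image_sub_le_of_norm_fderivWithin_le
    (hf.smooth.differentiableOn (by simp)) hb (x := (s, x, v)) (y := (t, x, v))
    ⟨hs, trivial⟩ ⟨ht, trivial⟩
  simpa [lift] using this

lemma SmoothRapidlyDecaying.exists_decay (hf : SmoothRapidlyDecaying cover T f)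
    (hc : Function.Surjective cover) (N : ℕ) :
    ∃ C, 0 ≤ C ∧ ∀ t ∈ Icc 0 T, ∀ x v, (1 + ‖x‖ + ‖v‖) ^ N * |f t x v| ≤ C := by
  obtain ⟨C, hC⟩ := hf.decay 0 N
  refine ⟨max C 0, le_max_right _ _, fun t ht x v => ?_⟩
  obtain ⟨y, rfl⟩ := hc x
  have := hC t ht y v
  rw [norm_iteratedFDerivWithin_zero] at this
  exact this.trans (le_max_left _ _)

/-- Clamping time to `[0,T]` gives a globally continuous function, and continuity descends from the
lift because `cover` is an open quotient map. -/
lemma SmoothRapidlyDecaying.continuous (hf : SmoothRapidlyDecaying cover T f)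
    (hc : IsOpenQuotientMap cover) (hT : 0 ≤ T) :
    Continuous fun q : ℝ × X × Vec3 => f (projIcc 0 T hT q.1) q.2.1 q.2.2 := by
  have hq : IsOpenQuotientMap
      (Prod.map id (Prod.map cover id) : ℝ × Vec3 × Vec3 → ℝ × X × Vec3) :=
    IsOpenQuotientMap.id.prodMap (hc.prodMap IsOpenQuotientMap.id)
  rw [← hq.continuous_comp_iff]
  have h1 : Continuous fun q : ℝ × Vec3 × Vec3 =>
      (((projIcc 0 T hT q.1 : ℝ), q.2) : ℝ × Vec3 × Vec3) := by fun_prop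
  exact hf.smooth.continuousOn.comp_continuous h1 fun q => ⟨(projIcc 0 T hT q.1).2, trivial⟩

lemma SmoothRapidlyDecaying.continuous_slice (hf : SmoothRapidlyDecaying cover T f)
    (hc : IsOpenQuotientMap cover) {t : ℝ} (ht : t ∈ Icc 0 T) :
    Continuous fun q : X × Vec3 => f t q.1 q.2 := by
  have h : Continuous fun q : X × Vec3 => ((t, q) : ℝ × X × Vec3) := by fun_prop
  have := (hf.continuous hc (ht.1.trans ht.2)).comp h
  simpa [Function.comp_def, projIcc_of_mem _ ht] using this

lemma SmoothRapidlyDecaying.differentiableAt (hf : SmoothRapidlyDecaying cover T f)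
    {t : ℝ} (ht : t ∈ Ioo 0 T) (x v : Vec3) :
    DifferentiableAt ℝ (fun s => f s (cover x) v) t := by
  have hn : Icc 0 T ×ˢ (univ : Set (Vec3 × Vec3)) ∈ 𝓝 (t, x, v) :=
    prod_mem_nhds (Icc_mem_nhds ht.1 ht.2) univ_mem
  have h := (hf.smooth.contDiffAt hn).differentiableAt (by simp)
  exact h.comp t (f := fun s : ℝ => ((s, x, v) : ℝ × Vec3 × Vec3)) (by fun_prop)

/-! ### The maximum principle. -/

lemma deriv_nonneg_of_left_max {g : ℝ → ℝ} {g' a : ℝ} (ha : 0 < a) (hg : HasDerivAt g g' a)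
    (hmax : ∀ s ∈ Icc 0 a, g s ≤ g a) : 0 ≤ g' := by
  have h := hasDerivWithinAt_iff_tendsto_slope' (s := Iio a) (by simp) |>.1 hg.hasDerivWithinAt
  refine ge_of_tendsto h ?_
  filter_upwards [Ioo_mem_nhdsLT ha] with s hs
  rw [slope_def_field]
  exact div_nonneg_of_nonpos (by linarith [hmax s ⟨hs.1.le, hs.2.le⟩]) (by linarith [hs.2])

/-- A continuous function with uniform decay in phase space attains its maximum over a time
interval as soon as it is positive somewhere. -/
lemma exists_max_of_decay [ProperSpace X] {W : ℝ × X × Vec3 → ℝ} (hW : Continuous W) {τ B : ℝ}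
    (hB : ∀ t ∈ Icc 0 τ, ∀ x v, (1 + ‖x‖ + ‖v‖) * W (t, x, v) ≤ B)
    {q₀ : ℝ × X × Vec3} (h0 : q₀.1 ∈ Icc 0 τ) (hpos : 0 < W q₀) :
    ∃ q : ℝ × X × Vec3, q.1 ∈ Icc 0 τ ∧ ∀ t ∈ Icc 0 τ, ∀ x v, W (t, x, v) ≤ W q := by
  set R := B / W q₀
  -- Points with value at least `W q₀` stay in a compact set, so a maximum over that set is global.
  have hfar : ∀ t ∈ Icc 0 τ, ∀ x v, W q₀ ≤ W (t, x, v) → 1 + ‖x‖ + ‖v‖ ≤ R := fun t ht x v h => by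
    rw [le_div_iff₀ hpos]
    exact (mul_le_mul_of_nonneg_left h (by positivity)).trans (hB t ht x v)
  set D : Set (ℝ × X × Vec3) := Icc 0 τ ×ˢ (Metric.closedBall 0 R ×ˢ Metric.closedBall 0 R)
  have hD : IsCompact D :=
    isCompact_Icc.prod ((isCompact_closedBall _ _).prod (isCompact_closedBall _ _))
  have hmem : ∀ t ∈ Icc 0 τ, ∀ x v, W q₀ ≤ W (t, x, v) → (t, x, v) ∈ D := fun t ht x v h => by
    have := hfar t ht x v h
    refine ⟨ht, ?_, ?_⟩ <;> rw [mem_closedBall_zero_iff] <;>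
      linarith [norm_nonneg x, norm_nonneg v]
  have hq₀ : q₀ ∈ D := hmem q₀.1 h0 q₀.2.1 q₀.2.2 le_rfl
  obtain ⟨q, hq, hmax⟩ := hD.exists_isMaxOn ⟨q₀, hq₀⟩ hW.continuousOn
  refine ⟨q, hq.1, fun t ht x v => ?_⟩
  by_cases h : W q₀ ≤ W (t, x, v)
  · exact hmax (hmem t ht x v h)
  · exact (not_le.1 h).le.trans (hmax hq₀)

/-- Maximum principle for the weighted density, with an artificial strict damping. -/
lemma weighted_le_of_damping [ProperSpace X] (hc : IsOpenQuotientMap cover) {m K : ℝ}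
    (hm : 0 ≤ m) (hm5 : m ≤ 5)
    (hK : ∀ (p : 𝓢(Vec3, ℝ)) (F G : ℝ) (v : Vec3),
      (∀ w, 0 ≤ p w) → (∀ w, p w ≤ F) → (∀ w, p w ≤ G * bracket w ^ (-m)) →
      p v = G * bracket v ^ (-m) → collision p v ≤ K * F * p v)
    (hf : SmoothRapidlyDecaying cover T f) (hf0 : ∀ t ∈ Icc 0 T, ∀ x v, 0 ≤ f t x v)
    (hsol : SolvesLandau cover T f) {F : ℝ → ℝ} (hF : Continuous F)
    (hfF : ∀ t ∈ Icc 0 T, ∀ x v, f t x v ≤ F t) {M : ℝ} (hM0 : 0 ≤ M)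
    (hM : ∀ x v, bracket v ^ m * f 0 x v ≤ M) {ε : ℝ} (hε : 0 < ε)
    {t : ℝ} (ht : t ∈ Ico 0 T) (x : X) (v : Vec3) :
    Real.exp (-(K * ∫ s in (0 : ℝ)..t, F s) - ε * t) * (bracket v ^ m * f t x v) ≤ M := by
  by_contra! hlt
  have hT : 0 < T := ht.1.trans_lt ht.2
  set E : ℝ → ℝ := fun t => Real.exp (-(K * ∫ s in (0 : ℝ)..t, F s) - ε * t) with hE
  have hEpos (s : ℝ) : 0 < E s := Real.exp_pos _
  have hEder (s : ℝ) : HasDerivAt E (E s * (-(K * F s) - ε)) s := by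
    have h1 := intervalIntegral.integral_hasDerivAt_right (hF.intervalIntegrable 0 s)
      (hF.stronglyMeasurableAtFilter _ _) hF.continuousAt
    have h2 := ((h1.const_mul K).neg.sub ((hasDerivAt_id s).const_mul ε)).exp
    simpa [E] using h2
  have hEcont : Continuous E := continuous_iff_continuousAt.2 fun s => (hEder s).continuousAt
  set W : ℝ × X × Vec3 → ℝ := fun q =>
    E q.1 * (bracket q.2.2 ^ m * f (projIcc 0 T hT.le q.1) q.2.1 q.2.2) with hWdef
  have hWeq (s : ℝ) (hs : s ∈ Icc 0 T) (y : X) (w : Vec3) :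
      W (s, y, w) = E s * (bracket w ^ m * f s y w) := by
    simp only [hWdef, projIcc_of_mem _ hs]
  have hWcont : Continuous W := by
    refine (hEcont.comp continuous_fst).mul (Continuous.mul ?_ (hf.continuous hc hT.le))
    exact (continuous_bracket.comp (by fun_prop)).rpow_const fun q => Or.inl (bracket_pos _).ne'
  have hsub : Icc 0 t ⊆ Icc 0 T := Icc_subset_Icc_right ht.2.le
  -- Five powers absorb the weight, since `m ≤ 5`; one is left for the decay of `W`.
  obtain ⟨C, -, hC⟩ := hf.exists_decay hc.surjective 6
  obtain ⟨C', hC'⟩ := isCompact_Icc.exists_bound_of_continuousOn (s := Icc 0 t) hEcont.continuousOn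
  have hdecay : ∀ s ∈ Icc 0 t, ∀ y w, (1 + ‖y‖ + ‖w‖) * W (s, y, w) ≤ C' * C := by
    intro s hs y w
    rw [hWeq s (hsub hs)]
    have h1 : E s ≤ C' := (le_abs_self _).trans (hC' s hs)
    have h2 := hC s (hsub hs) y w
    rw [abs_of_nonneg (hf0 s (hsub hs) y w)] at h2
    have hb1 : 1 ≤ 1 + ‖y‖ + ‖w‖ := by linarith [norm_nonneg y, norm_nonneg w]
    have h3 : bracket w ^ m ≤ (1 + ‖y‖ + ‖w‖) ^ 5 := by
      calc bracket w ^ m ≤ (1 + ‖y‖ + ‖w‖) ^ m :=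
            Real.rpow_le_rpow (bracket_pos w).le
              ((bracket_le w).trans (by linarith [norm_nonneg y])) hm
        _ ≤ (1 + ‖y‖ + ‖w‖) ^ (5 : ℝ) := Real.rpow_le_rpow_of_exponent_le hb1 hm5
        _ = (1 + ‖y‖ + ‖w‖) ^ 5 := by
            rw [← Real.rpow_natCast]; norm_num
    have hfn := hf0 s (hsub hs) y w
    calc (1 + ‖y‖ + ‖w‖) * (E s * (bracket w ^ m * f s y w))
        = E s * ((1 + ‖y‖ + ‖w‖) * bracket w ^ m * f s y w) := by ring
      _ ≤ C' * ((1 + ‖y‖ + ‖w‖) * (1 + ‖y‖ + ‖w‖) ^ 5 * f s y w) := by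
          have := (bracket_pos w)
          have h4 := (hEpos s).le.trans h1
          gcongr
      _ ≤ C' * C := by
          refine mul_le_mul_of_nonneg_left (le_trans (le_of_eq (by ring)) h2)
            ((hEpos s).le.trans h1)
  have htmem : t ∈ Icc 0 t := ⟨ht.1, le_rfl⟩
  have hW0 : M < W (t, x, v) := by rw [hWeq t (hsub htmem)]; exact hlt
  -- The maximum is over `[0,t]` with `t < T`, so `t₁ < T`; the initial bound excludes `t₁ = 0`.
  -- Hence the equation holds at `t₁`.
  obtain ⟨⟨t₁, x₁, v₁⟩, ht₁, hmax⟩ := exists_max_of_decay hWcont hdecay (q₀ := (t, x, v)) htmem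
    (hM0.trans_lt hW0)
  have hW1 : M < W (t₁, x₁, v₁) := hW0.trans_le (hmax t htmem x v)
  have ht₁T : t₁ ∈ Icc 0 T := hsub ht₁
  have ht₁pos : 0 < t₁ := by
    refine lt_of_le_of_ne ht₁.1 fun h => ?_
    have h0 := hM x₁ v₁
    rw [← h, hWeq 0 ⟨le_rfl, hT.le⟩] at hW1
    simp [E] at hW1
    linarith
  have ht₁o : t₁ ∈ Ioo 0 T := ⟨ht₁pos, ht₁.2.trans_lt ht.2⟩
  have hb (w : Vec3) : 0 < bracket w ^ m := Real.rpow_pos_of_pos (bracket_pos w) m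
  have hslice (y : X) (w : Vec3) :
      bracket w ^ m * f t₁ y w ≤ bracket v₁ ^ m * f t₁ x₁ v₁ := by
    have := hmax t₁ ht₁ y w
    simp only [hWeq t₁ ht₁T] at this
    exact le_of_mul_le_mul_left this (hEpos t₁)
  have hfpos : 0 < f t₁ x₁ v₁ := by
    rw [hWeq t₁ ht₁T] at hW1
    have h1 := pos_of_mul_pos_right (hM0.trans_lt hW1) (hEpos t₁).le
    exact pos_of_mul_pos_right h1 (hb v₁).le
  obtain ⟨y₁, rfl⟩ := hc.surjective x₁
  obtain ⟨p, hp⟩ := hf.exists_schwartz hT ht₁T y₁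
  have hcoll : collision (f t₁ (cover y₁)) v₁ ≤ K * F t₁ * f t₁ (cover y₁) v₁ := by
    rw [← hp]
    refine hK p (F t₁) (bracket v₁ ^ m * p v₁) v₁ ?_ ?_ ?_ ?_
    · intro w; rw [hp]; exact hf0 t₁ ht₁T _ _
    · intro w; rw [hp]; exact hfF t₁ ht₁T _ _
    · intro w
      rw [hp, Real.rpow_neg (bracket_pos w).le, ← div_eq_mul_inv, le_div_iff₀ (hb w), mul_comm]
      exact hslice _ w
    · rw [Real.rpow_neg (bracket_pos v₁).le, mul_comm (bracket v₁ ^ m), mul_assoc,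
        mul_inv_cancel₀ (hb v₁).ne', mul_one]
  have hgrad : gradient (fun y => f t₁ (cover y) v₁) y₁ = 0 := by
    have : IsLocalMax (fun y => f t₁ (cover y) v₁) y₁ :=
      .of_forall fun y => le_of_mul_le_mul_left (hslice (cover y) v₁) (hb v₁)
    rw [gradient, this.fderiv_eq_zero, map_zero]
  have heq := hsol t₁ ht₁o y₁ v₁
  rw [hgrad, inner_zero_right, add_zero] at heq
  have hder := (hf.differentiableAt ht₁o y₁ v₁).hasDerivAt
  rw [heq] at hder
  have hWder := (hEder t₁).mul (hder.const_mul (bracket v₁ ^ m))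
  -- Since `t₁` may equal `t`, only earlier times are compared. The derivative is therefore
  -- nonnegative, whereas the equation makes it at most `-ε W < 0`.
  have hnn := deriv_nonneg_of_left_max ht₁pos hWder fun s hs => by
    have hs' : s ∈ Icc 0 t := ⟨hs.1, hs.2.trans ht₁.2⟩
    have := hmax s hs' (cover y₁) v₁
    simpa only [Pi.mul_apply, hWeq s (hsub hs'), hWeq t₁ ht₁T] using this
  have e : E t₁ * (-(K * F t₁) - ε) * (bracket v₁ ^ m * f t₁ (cover y₁) v₁)
      + E t₁ * (bracket v₁ ^ m * collision (f t₁ (cover y₁)) v₁)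
      = E t₁ * bracket v₁ ^ m * (collision (f t₁ (cover y₁)) v₁
        - K * F t₁ * f t₁ (cover y₁) v₁ - ε * f t₁ (cover y₁) v₁) := by ring
  rw [e] at hnn
  have := nonneg_of_mul_nonneg_right hnn (mul_pos (hEpos t₁) (hb v₁))
  have := mul_pos hε hfpos
  linarith

/-- Propagation of the weighted sup bound. -/
theorem weighted_le [ProperSpace X] (hc : IsOpenQuotientMap cover) {m K : ℝ}
    (hm : 0 ≤ m) (hm5 : m ≤ 5)
    (hK : ∀ (p : 𝓢(Vec3, ℝ)) (F G : ℝ) (v : Vec3),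
      (∀ w, 0 ≤ p w) → (∀ w, p w ≤ F) → (∀ w, p w ≤ G * bracket w ^ (-m)) →
      p v = G * bracket v ^ (-m) → collision p v ≤ K * F * p v)
    (hf : SmoothRapidlyDecaying cover T f) (hf0 : ∀ t ∈ Icc 0 T, ∀ x v, 0 ≤ f t x v)
    (hsol : SolvesLandau cover T f) (hT : 0 < T) {F : ℝ → ℝ} (hF : Continuous F)
    (hfF : ∀ t ∈ Icc 0 T, ∀ x v, f t x v ≤ F t) {M : ℝ} (hM0 : 0 ≤ M)
    (hM : ∀ x v, bracket v ^ m * f 0 x v ≤ M) {t : ℝ} (ht : t ∈ Icc 0 T) (x : X) (v : Vec3) :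
    bracket v ^ m * f t x v ≤ Real.exp (K * ∫ s in (0 : ℝ)..t, F s) * M := by
  have hIco : ∀ t ∈ Ico 0 T,
      bracket v ^ m * f t x v ≤ Real.exp (K * ∫ s in (0 : ℝ)..t, F s) * M := by
    intro t ht
    have hlim : Tendsto (fun ε : ℝ =>
        Real.exp (-(K * ∫ s in (0 : ℝ)..t, F s) - ε * t) * (bracket v ^ m * f t x v)) (𝓝[>] 0)
        (𝓝 (Real.exp (-(K * ∫ s in (0 : ℝ)..t, F s)) * (bracket v ^ m * f t x v))) := by
      have : Continuous fun ε : ℝ =>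
        Real.exp (-(K * ∫ s in (0 : ℝ)..t, F s) - ε * t) * (bracket v ^ m * f t x v) := by
        fun_prop
      have := (this.tendsto 0).mono_left (nhdsWithin_le_nhds (s := Ioi 0))
      simpa using this
    have := le_of_tendsto hlim (by
      filter_upwards [self_mem_nhdsWithin] with ε hε
      exact weighted_le_of_damping hc hm hm5 hK hf hf0 hsol hF hfF hM0 hM hε ht x v)
    rwa [Real.exp_neg, inv_mul_le_iff₀ (Real.exp_pos _)] at this
  -- The end time `T` is reached by continuity.
  have hcl : t ∈ closure (Ico 0 T) := by rwa [closure_Ico hT.ne]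
  have hl : Continuous fun t : ℝ => bracket v ^ m * f (projIcc 0 T hT.le t) x v :=
    continuous_const.mul ((hf.continuous hc hT.le).comp
      (f := fun t : ℝ => ((t, x, v) : ℝ × X × Vec3)) (by fun_prop))
  have hint : Continuous fun t : ℝ => ∫ s in (0 : ℝ)..t, F s :=
    intervalIntegral.continuous_primitive (fun a b => hF.intervalIntegrable a b) 0
  have hr : Continuous fun t : ℝ => Real.exp (K * ∫ s in (0 : ℝ)..t, F s) * M := by fun_prop
  have := le_on_closure (s := Ico 0 T) (fun s hs => by
    have := hIco s hs
    simpa only [projIcc_of_mem hT.le (Ico_subset_Icc_self hs)] using this)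
    hl.continuousOn hr.continuousOn hcl
  simpa only [projIcc_of_mem hT.le ht] using this

end

/-! ### From pointwise bounds to `L^∞` norms. -/

lemma normLinf_le {X : Type} [MeasureSpace X] {g : X → Vec3 → ℝ} {B : ℝ} (h : ∀ x v, |g x v| ≤ B) :
    normLinf g ≤ ENNReal.ofReal B := by
  refine (eLpNorm_exponent_top).trans_le (eLpNormEssSup_le_of_ae_bound (C := B) ?_)
  exact .of_forall fun q => h q.1 q.2

lemma toReal_normLinf_le {X : Type} [MeasureSpace X] {g : X → Vec3 → ℝ} {B : ℝ} (h0 : 0 ≤ B) (h : ∀ x v, |g x v| ≤ B) :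
    (normLinf g).toReal ≤ B := by
  have := ENNReal.toReal_mono ENNReal.ofReal_ne_top (normLinf_le h)
  rwa [ENNReal.toReal_ofReal h0] at this

section
variable {X : Type} [NormedAddCommGroup X] [MeasureSpace X]

/-- For continuous `g` the set where the bound holds is closed, and having full measure it is dense.
-/
lemma enorm_le_normLinf [(volume : Measure X).IsOpenPosMeasure] [SFinite (volume : Measure X)]
    {g : X → Vec3 → ℝ} (hg : Continuous fun q : X × Vec3 => g q.1 q.2) (x : X) (v : Vec3) :
    ‖g x v‖ₑ ≤ normLinf g := by
  have : (volume : Measure (X × Vec3)).IsOpenPosMeasure :=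
    inferInstanceAs ((volume : Measure X).prod (volume : Measure Vec3)).IsOpenPosMeasure
  have hae : ∀ᵐ q : X × Vec3, ‖g q.1 q.2‖ₑ ≤ normLinf g := by
    rw [normLinf, eLpNorm_exponent_top]
    exact enorm_ae_le_eLpNormEssSup _ _
  have hcl : IsClosed {q : X × Vec3 | ‖g q.1 q.2‖ₑ ≤ normLinf g} :=
    isClosed_le hg.enorm continuous_const
  have := (Measure.dense_of_ae hae).closure_eq
  rw [hcl.closure_eq] at this
  exact (this ▸ mem_univ (x, v) : (x, v) ∈ {q : X × Vec3 | ‖g q.1 q.2‖ₑ ≤ normLinf g})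

lemma abs_le_toReal_normLinf [(volume : Measure X).IsOpenPosMeasure] [SFinite (volume : Measure X)]
    {g : X → Vec3 → ℝ} (hg : Continuous fun q : X × Vec3 => g q.1 q.2) {B : ℝ}
    (hB : ∀ x v, |g x v| ≤ B) (x : X) (v : Vec3) : |g x v| ≤ (normLinf g).toReal := by
  have hfin : normLinf g ≠ ⊤ := ((normLinf_le hB).trans_lt ENNReal.ofReal_lt_top).ne
  have := ENNReal.toReal_mono hfin (enorm_le_normLinf hg x v)
  simpa using this

variable {cover : Vec3 → X} {T : ℝ} {f : ℝ → X → Vec3 → ℝ}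

/-- The `L^∞` norm of a smooth rapidly decaying density depends continuously on time. -/
lemma SmoothRapidlyDecaying.continuousOn_normLinf [(volume : Measure X).IsOpenPosMeasure]
    [SFinite (volume : Measure X)] (hf : SmoothRapidlyDecaying cover T f)
    (hc : IsOpenQuotientMap cover) (hT : 0 < T) :
    ContinuousOn (fun s => (normLinf (f s)).toReal) (Icc 0 T) := by
  obtain ⟨C, -, hC⟩ := hf.exists_decay hc.surjective 0
  simp only [pow_zero, one_mul] at hC
  obtain ⟨L, hL⟩ := hf.exists_lipschitz hT
  have hL0 : 0 ≤ L := by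
    have := (abs_nonneg _).trans (hL 0 ⟨le_rfl, hT.le⟩ T ⟨hT.le, le_rfl⟩ 0 0)
    exact nonneg_of_mul_nonneg_left this (by simpa using hT.ne')
  -- The time-Lipschitz constant of `f`, uniform in phase space, passes to the sup norm.
  have key : ∀ s ∈ Icc 0 T, ∀ t ∈ Icc 0 T,
      (normLinf (f t)).toReal ≤ (normLinf (f s)).toReal + L * |t - s| := by
    intro s hs t ht
    refine toReal_normLinf_le (by positivity) fun x v => ?_
    have h1 := abs_le_toReal_normLinf (hf.continuous_slice hc hs) (hC s hs) x v
    obtain ⟨y, rfl⟩ := hc.surjective x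
    have h2 := hL s hs t ht y v
    have h3 := abs_add_le (f s (cover y) v) (f t (cover y) v - f s (cover y) v)
    rw [add_sub_cancel] at h3
    linarith
  refine LipschitzOnWith.continuousOn (K := ⟨L, hL0⟩) (LipschitzOnWith.of_dist_le_mul ?_)
  intro s hs t ht
  have h1 := key s hs t ht
  have h2 := key t ht s hs
  rw [abs_sub_comm t s] at h1
  rw [Real.dist_eq, Real.dist_eq, abs_le]
  change -(L * |s - t|) ≤ _ ∧ _ ≤ L * |s - t|
  constructor <;> linarith

/-- The weighted estimate for a general position space covered by `ℝ³`. -/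
theorem normLinfWeighted_le [ProperSpace X] [(volume : Measure X).IsOpenPosMeasure]
    [SFinite (volume : Measure X)] (hc : IsOpenQuotientMap cover) {m K : ℝ}
    (hm : 0 ≤ m) (hm5 : m ≤ 5)
    (hK : ∀ (p : 𝓢(Vec3, ℝ)) (F G : ℝ) (v : Vec3),
      (∀ w, 0 ≤ p w) → (∀ w, p w ≤ F) → (∀ w, p w ≤ G * bracket w ^ (-m)) →
      p v = G * bracket v ^ (-m) → collision p v ≤ K * F * p v)
    (hf : SmoothRapidlyDecaying cover T f) (hf0 : ∀ t ∈ Icc 0 T, ∀ x v, 0 ≤ f t x v)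
    (hsol : SolvesLandau cover T f) {t : ℝ} (ht : t ∈ Icc 0 T) :
    normLinfWeighted m (f t) ≤
      ENNReal.ofReal (Real.exp (K * ∫ s in (0 : ℝ)..t, (normLinf (f s)).toReal)) *
        normLinfWeighted m (f 0) := by
  rcases (ht.1.trans ht.2).eq_or_lt with rfl | hT
  · obtain rfl : t = 0 := le_antisymm ht.2 ht.1
    simp
  have h0T : (0 : ℝ) ∈ Icc 0 T := ⟨le_rfl, hT.le⟩
  -- If the initial norm is infinite the right side is `⊤`, the exponential being positive.
  rcases eq_or_ne (normLinfWeighted m (f 0)) ⊤ with htop | hfin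
  · rw [htop, ENNReal.mul_top (by simpa using Real.exp_pos _)]
    exact le_top
  obtain ⟨C, -, hC⟩ := hf.exists_decay hc.surjective 0
  simp only [pow_zero, one_mul] at hC
  have hbr : Continuous fun q : X × Vec3 => bracket q.2 ^ m :=
    (continuous_bracket.comp continuous_snd).rpow_const fun q => Or.inl (bracket_pos _).ne'
  set M := (normLinfWeighted m (f 0)).toReal with hMdef
  have hM (x : X) (v : Vec3) : bracket v ^ m * f 0 x v ≤ M := by
    have h := ENNReal.toReal_mono hfin (enorm_le_normLinf (g := fun x v => bracket v ^ m * f 0 x v)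
      (hbr.mul (hf.continuous_slice hc h0T)) x v)
    rw [toReal_enorm] at h
    exact (le_abs_self _).trans h
  set F : ℝ → ℝ := fun s => (normLinf (f (projIcc 0 T hT.le s))).toReal with hFdef
  have hF : Continuous F :=
    (hf.continuousOn_normLinf hc hT).comp_continuous (by fun_prop) fun s => (projIcc 0 T hT.le s).2
  have hFeq (s : ℝ) (hs : s ∈ Icc 0 T) : F s = (normLinf (f s)).toReal := by
    simp only [hFdef, projIcc_of_mem _ hs]
  have hfF : ∀ s ∈ Icc 0 T, ∀ x v, f s x v ≤ F s := fun s hs x v => by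
    rw [hFeq s hs]
    exact (le_abs_self _).trans
      (abs_le_toReal_normLinf (hf.continuous_slice hc hs) (hC s hs) x v)
  have hint : ∫ s in (0 : ℝ)..t, (normLinf (f s)).toReal = ∫ s in (0 : ℝ)..t, F s := by
    refine intervalIntegral.integral_congr fun s hs => ?_
    rw [uIcc_of_le ht.1] at hs
    exact (hFeq s ⟨hs.1, hs.2.trans ht.2⟩).symm
  have main := weighted_le hc hm hm5 hK hf hf0 hsol hT hF hfF ENNReal.toReal_nonneg hM ht
  rw [hint, ← ENNReal.ofReal_toReal hfin, ← hMdef, ← ENNReal.ofReal_mul (Real.exp_pos _).le]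
  refine normLinf_le fun x v => ?_
  rw [abs_of_nonneg (mul_nonneg (Real.rpow_nonneg (bracket_pos v).le m) (hf0 t ht x v))]
  exact main x v

end

/-! ### The whole space and the torus. -/

lemma isOpenQuotientMap_toTorus : IsOpenQuotientMap toTorus := by
  have h1 : IsOpenQuotientMap (Pi.map fun (_ : Fin 3) (x : ℝ) => (x : UnitAddCircle)) :=
    IsOpenQuotientMap.piMap fun _ => QuotientAddGroup.isOpenQuotientMap_mk
  exact h1.comp (EuclideanSpace.equiv (Fin 3) ℝ).toHomeomorph.isOpenQuotientMap

end Landau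

theorem proposition1p3 (m : ℝ) (hm2 : 2 < m) (hm5 : m < 5) (hm : ∀ n : ℤ, m ≠ n) :
    ∃ K : ℝ,
      (∀ (T : ℝ) (f : ℝ → Landau.Vec3 → Landau.Vec3 → ℝ),
        Landau.SmoothRapidlyDecaying id T f →
        (∀ t ∈ Set.Icc 0 T, ∀ x v, 0 ≤ f t x v) →
        Landau.SolvesLandau id T f →
        ∀ t ∈ Set.Icc 0 T,
          Landau.normLinfWeighted m (f t) ≤
            ENNReal.ofReal (Real.exp (K * ∫ s in (0 : ℝ)..t, (Landau.normLinf (f s)).toReal)) *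
              Landau.normLinfWeighted m (f 0)) ∧
      (∀ (T : ℝ) (f : ℝ → Landau.Torus3 → Landau.Vec3 → ℝ),
        Landau.SmoothRapidlyDecaying Landau.toTorus T f →
        (∀ t ∈ Set.Icc 0 T, ∀ x v, 0 ≤ f t x v) →
        Landau.SolvesLandau Landau.toTorus T f →
        ∀ t ∈ Set.Icc 0 T,
          Landau.normLinfWeighted m (f t) ≤
            ENNReal.ofReal (Real.exp (K * ∫ s in (0 : ℝ)..t, (Landau.normLinf (f s)).toReal)) *
              Landau.normLinfWeighted m (f 0)) := by
  obtain ⟨K, hK⟩ := Landau.exists_collision_le hm2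
  have hm0 : 0 ≤ m := by linarith
  -- The constant comes from an estimate in velocity alone, so it serves both domains.
  exact ⟨K,
    fun T f hf hf0 hsol t ht =>
      Landau.normLinfWeighted_le IsOpenQuotientMap.id hm0 hm5.le hK hf hf0 hsol ht,
    fun T f hf hf0 hsol t ht =>
      Landau.normLinfWeighted_le Landau.isOpenQuotientMap_toTorus hm0 hm5.le hK hf hf0 hsol ht⟩
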